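/- For nonnegative integers $j,n$ let $\vartheta_2(j,n)$ be the number of $t\in\{0,\dots,n\}$ such that $\nu_2\binom nt=j$, where $\nu_2$ is the $2$-adic valuation. A binary word $w=w_{\mu-1}\cdots w_0$ is called admissible if $\mu\ge 2$, $w_{\mu-1}=1$ and $w_0=0$; for such $w$ let $|n|_w$ be the number of (possibly overlapping) occurrences of $w$ as a factor of the binary expansion of $n$ (padded with zeros on the left). For every $j\ge 0$ there is a unique polynomial $P_j$ with real coefficients in the variables $X_w$ ($w$ admissible) such that $\vartheta_2(j,n)/\vartheta_2(0,n)=P_j\bigl((|n|_w)_w\bigr)$ for all $n\ge 0$. Let $\overline T_n(x)=\frac1{\vartheta_2(0,n)}\sum_{0\le t\le n}x^{\nu_2\binom nt}$, and for a binary word $v$ put $\overline T_v=\overline T_n$, where $n$ is the integer represented by $v$ in base $2$ ($n=0$ for the empty word). For a word $w$ starting with $1$ let $w_R$ be $w$ without its last digit, let $w_L$ be $w$ without its first digit and without all zeros that then lead, and let $w_{LR}=(w_L)_R$, where $R$ fixes the empty word. Define the rational function $$r_w(x)=\frac{\overline T_w(x)\,\overline T_{w_{LR}}(x)}{\overline T_{w_R}(x)\,\overline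 T_{w_L}(x)}.$$ Let $s\ge 1$ and $k\ge 0$ be integers, let $w=1^s0$ or $w=1^{4s+1}00$, and let $c_j$ be the coefficient of the monomial $X_w^k$ in $P_j$. Then the radius of convergence of $\sum_{j\ge 0}c_jx^j$ is greater than $1$, and $$\sum_{j\ge 0}c_j=\frac1{k!}\bigl(\log r_w(1)\bigr)^k .$$ Moreover, if $w=1^s0$ and $k\ge 1$, this radius of convergence is equal to $2$. -/

import Mathlib

namespace PascalRows

noncomputable section

/-- `theta p j n` is the number of entries of the `n`-th row of Pascal's triangle that are divisible
by `p ^ j` and not by `p ^ (j + 1)`. -/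
def theta (p j n : ℕ) : ℕ :=
  ((Finset.range (n + 1)).filter fun t => padicValNat p (n.choose t) = j).card

/-! Words over the digits `0, …, p - 1` are lists that are read from left to right: the list
`[w_{μ-1}, …, w_0]` is the word `w_{μ-1} ⋯ w_0`, whose least significant digit is the last one. -/

/-- The integer `(w)_p` represented by the word `w` in base `p` (it is `0` for the empty word). -/
def wordValue (p : ℕ) (w : List ℕ) : ℕ := Nat.ofDigits p w.reverse

/-- The factor count `|n|_w`: the number of positions `i ≥ 0` at which `w` occurs in the base-`p`
expansion of `n`, padded with infinitely many zeros on the left. (The set of these positions is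
finite as soon as `w` contains a nonzero digit.) -/
def factorCount (p : ℕ) (w : List ℕ) (n : ℕ) : ℕ :=
  Set.ncard {i : ℕ | ∀ m < w.length, (Nat.digits p n).getD (i + m) 0 = w.reverse.getD m 0}

/-- The set `W` of admissible words: words in the digits `0, …, p - 1` of length at least `2` whose
leftmost digit is not `0` and whose rightmost digit is not `p - 1`. -/
def Admissible (p : ℕ) (w : List ℕ) : Prop :=
  2 ≤ w.length ∧ (∀ a ∈ w, a < p) ∧ w.head? ≠ some 0 ∧ w.getLast? ≠ some (p - 1)

/-- The type of admissible words; it indexes the variables `X_w`. -/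
abbrev AdmissibleWord (p : ℕ) : Type := {w : List ℕ // Admissible p w}

/-- `Q` is a polynomial in the variables `X_w` (`w` admissible) such that
`theta p j n / theta p 0 n` is the value of `Q` at `X_w = |n|_w`, for all `n ≥ 0`. -/
def Represents (p j : ℕ) (Q : MvPolynomial (AdmissibleWord p) ℝ) : Prop :=
  ∀ n : ℕ, (theta p j n : ℝ) / (theta p 0 n : ℝ) =
    MvPolynomial.eval (fun w : AdmissibleWord p => (factorCount p w.1 n : ℝ)) Q

/-- `T_n(x) = ∑_{0 ≤ t ≤ n} x ^ ν_p(binom(n, t))`. -/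
def T (p n : ℕ) : Polynomial ℝ :=
  ∑ t ∈ Finset.range (n + 1), Polynomial.X ^ padicValNat p (n.choose t)

/-- The normalized polynomial `T_n / theta p 0 n`, whose constant term is `1`. -/
def Tbar (p n : ℕ) : Polynomial ℝ := Polynomial.C ((theta p 0 n : ℝ)⁻¹) * T p n

/-- The normalized polynomial of the integer represented by a word. -/
def TbarWord (p : ℕ) (w : List ℕ) : Polynomial ℝ := Tbar p (wordValue p w)

/-- Left truncation of a word: the leftmost digit is removed, and then all leading zeros. -/
def truncL (w : List ℕ) : List ℕ := w.tail.dropWhile (· == 0)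

/-- Right truncation of a word: the rightmost digit is removed. -/
def truncR (w : List ℕ) : List ℕ := w.dropLast

/-- The rational function `r_w = T̄_w T̄_{w_LR} / (T̄_{w_R} T̄_{w_L})`. -/
def r (p : ℕ) (w : List ℕ) : RatFunc ℝ :=
  (algebraMap (Polynomial ℝ) (RatFunc ℝ) (TbarWord p w) *
      algebraMap (Polynomial ℝ) (RatFunc ℝ) (TbarWord p (truncR (truncL w)))) /
    (algebraMap (Polynomial ℝ) (RatFunc ℝ) (TbarWord p (truncR w)) *
      algebraMap (Polynomial ℝ) (RatFunc ℝ) (TbarWord p (truncL w)))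

/-- The coefficient of the monomial `X_w ^ k` in `Q`. -/
def coeffPow {p : ℕ} (w : AdmissibleWord p) (k : ℕ) (Q : MvPolynomial (AdmissibleWord p) ℝ) : ℝ :=
  Q.coeff (Finsupp.single w k)

/-- The radius of convergence of the power series `∑_j c_j x ^ j` in a complex variable `x`. -/
def radiusOfConvergence (c : ℕ → ℝ) : ENNReal :=
  (FormalMultilinearSeries.ofScalars ℂ (fun j => (c j : ℂ))).radius

/-- The word `1^s 0`. -/
def wordOne (s : ℕ) : List ℕ := List.replicate s 1 ++ [0]

/-- The word `1^{4s+1} 0 0`. -/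
def wordTwo (s : ℕ) : List ℕ := List.replicate (4 * s + 1) 1 ++ [0, 0]

theorem admissible_wordOne {s : ℕ} (hs : 1 ≤ s) : Admissible 2 (wordOne s) := by
  obtain ⟨t, rfl⟩ := Nat.exists_eq_add_of_le' hs
  refine ⟨by simp [wordOne], ?_, by simp [wordOne, List.replicate_succ], by simp [wordOne]⟩
  intro a ha
  simp [wordOne] at ha
  omega

theorem admissible_wordTwo (s : ℕ) : Admissible 2 (wordTwo s) := by
  refine ⟨by simp [wordTwo], ?_, by simp [wordTwo, List.replicate_succ], by simp [wordTwo]⟩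
  intro a ha
  simp [wordTwo] at ha
  omega

end

end PascalRows

/-! Write `T̄_n` for `Tbar 2 n`. Counting carries gives `T̄_{2n+1} = T̄_n`, and the quotient `q_n =
T̄_{2n} / T̄_n` satisfies `q_{2n+1} = 1 + (x/2) q_n` and `q_{2n} = 1 + 2x (1 - 1/q_n)`. Hence `T̄_n`
is a product of quotients `q_m`, one for each binary zero of `n`, where `m` is what precedes that
zero. Moreover `q_m` modulo `x^(a+1)` depends only on `m` modulo `2^a`
(`X_pow_dvd_ratioSeries_sub`).

Telescoping over the suffixes of `m` that start with 1 turns this into `T̄_n = ∏_w r_w ^ |n|_w`,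
where `w` is `binary(M) 0`; it is handled through logarithmic derivatives (`coeff_dlog_rowSeries`).
Each coefficient involves finitely many words, so `P_j` is the coefficient of `x^j` in `exp (∑_w X_w
log r_w)`. Uniqueness holds because, for finitely many words, the count vectors contain an additive
monoid spanning the whole space (`eq_zero_of_eval_counts`).

Reading off `X_w^k` gives the formal identity `∑_j c_j x^j = (log r_w)^k / k!`. If the numerator and
denominator of `r_w` have no zeros in a disc, `log r_w` is holomorphic there and the series
converges to it (`exists_log`); a disc of radius greater than 1 allows evaluation at 1. A zero of
the numerator alone on the boundary circle caps the radius (`radius_le_of_zero`).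

For `1^s 0` the zeros come from `(1 - x/2) T̄ = 1 - (x/2)^(s+1)` and lie on `|x| = 2`. For `1^m 00`
the equation is `1 + x² = (x/2)^(m+1) (1 + 2x)`; a zero in the closed unit disc would be very close
to `±i`, and for `m = 4s` and `m = 4s + 1` the sign of a real part rules that out
(`rotated_equation_ne`). -/

namespace PascalRows

open Finset

/-! ### Recurrences for the row polynomials -/

/-- The number of carries in the binary addition `a + b`. -/
noncomputable def carries (a b : ℕ) : ℕ := padicValNat 2 ((a + b).choose a)

theorem sum_digits_double (a : ℕ) : (Nat.digits 2 (2 * a)).sum = (Nat.digits 2 a).sum := by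
  rcases Nat.eq_zero_or_pos a with rfl | h
  · simp
  · simpa using congrArg List.sum (Nat.digits_add 2 (by norm_num) 0 a (by norm_num) (Or.inr h.ne'))

theorem sum_digits_double_add_one (a : ℕ) :
    (Nat.digits 2 (2 * a + 1)).sum = (Nat.digits 2 a).sum + 1 := by
  have := congrArg List.sum
    (Nat.digits_add 2 (by norm_num) 1 a (by norm_num) (Or.inl (by norm_num)))
  rw [List.sum_cons] at this
  rw [add_comm (2 * a), this, add_comm]

/-- Legendre's formula in additive form, so that every carry identity below is linear arithmetic in
digit sums. Subadditivity of the digit sum is proved to undo the truncated subtraction. -/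
theorem sum_digits_add (a b : ℕ) :
    (Nat.digits 2 a).sum + (Nat.digits 2 b).sum = (Nat.digits 2 (a + b)).sum + carries a b := by
  have h := sub_one_mul_padicValNat_choose_eq_sub_sum_digits' (p := 2) (k := a) (n := b)
  have hle : (Nat.digits 2 (a + b)).sum ≤ (Nat.digits 2 a).sum + (Nat.digits 2 b).sum := by
    have key : ∀ N a b : ℕ, a + b ≤ N →
        (Nat.digits 2 (a + b)).sum ≤ (Nat.digits 2 a).sum + (Nat.digits 2 b).sum := by
      intro N
      induction N with
      | zero => intro a b h; simp [show a = 0 by omega, show b = 0 by omega]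
      | succ N ih =>
        intro a b hab
        rcases Nat.eq_zero_or_pos a with rfl | ha
        · simp
        rcases Nat.eq_zero_or_pos b with rfl | hb
        · simp
        rcases Nat.even_or_odd' a with ⟨u, rfl | rfl⟩ <;>
          rcases Nat.even_or_odd' b with ⟨v, rfl | rfl⟩
        · have := ih u v (by omega)
          rw [← mul_add]; simpa only [sum_digits_double] using this
        · have := ih u v (by omega)
          rw [← add_assoc, ← mul_add]
          simp only [sum_digits_double, sum_digits_double_add_one]; omega
        · have := ih u v (by omega)
          rw [show 2 * u + 1 + 2 * v = 2 * (u + v) + 1 by ring]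
          simp only [sum_digits_double, sum_digits_double_add_one]; omega
        · have := ih u v (by omega)
          have h1 := ih (u + v) 1 (by omega)
          rw [show 2 * u + 1 + (2 * v + 1) = 2 * (u + v + 1) by ring]
          simp only [sum_digits_double, sum_digits_double_add_one]
          rw [show (Nat.digits 2 1).sum = 1 by simp] at h1
          omega
    exact key _ a b le_rfl
  rw [add_comm b a] at h
  unfold carries
  omega

theorem carries_double_double (a b : ℕ) : carries (2 * a) (2 * b) = carries a b := by
  have h := sum_digits_add (2 * a) (2 * b)
  rw [← mul_add] at h
  simp only [sum_digits_double] at h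
  have := sum_digits_add a b
  omega

theorem carries_double_odd (a b : ℕ) : carries (2 * a) (2 * b + 1) = carries a b := by
  have h := sum_digits_add (2 * a) (2 * b + 1)
  rw [show 2 * a + (2 * b + 1) = 2 * (a + b) + 1 by ring] at h
  simp only [sum_digits_double, sum_digits_double_add_one] at h
  have := sum_digits_add a b
  omega

theorem carries_odd_double (a b : ℕ) : carries (2 * a + 1) (2 * b) = carries a b := by
  have h := sum_digits_add (2 * a + 1) (2 * b)
  rw [show 2 * a + 1 + 2 * b = 2 * (a + b) + 1 by ring] at h
  simp only [sum_digits_double, sum_digits_double_add_one] at h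
  have := sum_digits_add a b
  omega

/-- The carry out of the units column meets a 0 as lowest digit of `a + b` and is absorbed there. -/
theorem carries_odd_odd_of_even {a b n : ℕ} (hab : a + b = 2 * n) :
    carries (2 * a + 1) (2 * b + 1) = carries a b + 1 := by
  have h := sum_digits_add (2 * a + 1) (2 * b + 1)
  have h' := sum_digits_add a b
  rw [show 2 * a + 1 + (2 * b + 1) = 2 * (2 * n + 1) by omega] at h
  rw [hab] at h'
  simp only [sum_digits_double, sum_digits_double_add_one] at h h'
  omega

theorem carries_four_add_one_three (v w : ℕ) :
    carries (4 * v + 1) (4 * w + 3) = carries (2 * v + 1) (2 * w + 1) + 1 := by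
  have h := sum_digits_add (4 * v + 1) (4 * w + 3)
  have h' := sum_digits_add (2 * v + 1) (2 * w + 1)
  rw [show 4 * v + 1 + (4 * w + 3) = 2 * (2 * (v + w + 1)) by ring,
    show 4 * v + 1 = 2 * (2 * v) + 1 by ring, show 4 * w + 3 = 2 * (2 * w + 1) + 1 by ring] at h
  rw [show 2 * v + 1 + (2 * w + 1) = 2 * (v + w + 1) by ring] at h'
  simp only [sum_digits_double, sum_digits_double_add_one] at h h'
  rw [show 4 * v + 1 = 2 * (2 * v) + 1 by ring, show 4 * w + 3 = 2 * (2 * w + 1) + 1 by ring]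
  omega

theorem carries_four_add_three_one (v w : ℕ) :
    carries (4 * v + 3) (4 * w + 1) = carries (2 * v + 1) (2 * w + 1) + 1 := by
  have h := sum_digits_add (4 * v + 3) (4 * w + 1)
  have h' := sum_digits_add (2 * v + 1) (2 * w + 1)
  rw [show 4 * v + 3 + (4 * w + 1) = 2 * (2 * (v + w + 1)) by ring,
    show 4 * w + 1 = 2 * (2 * w) + 1 by ring, show 4 * v + 3 = 2 * (2 * v + 1) + 1 by ring] at h
  rw [show 2 * v + 1 + (2 * w + 1) = 2 * (v + w + 1) by ring] at h'
  simp only [sum_digits_double, sum_digits_double_add_one] at h h'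
  rw [show 4 * w + 1 = 2 * (2 * w) + 1 by ring, show 4 * v + 3 = 2 * (2 * v + 1) + 1 by ring]
  omega

theorem T_eq_sum_carries (n : ℕ) :
    T 2 n = ∑ t ∈ range (n + 1), (Polynomial.X : Polynomial ℝ) ^ carries t (n - t) := by
  unfold T carries
  refine sum_congr rfl fun t ht => ?_
  rw [Nat.add_sub_cancel' (by simpa [Nat.lt_succ_iff] using ht)]

theorem sum_range_double {M : Type*} [AddCommMonoid M] (f : ℕ → M) (n : ℕ) :
    ∑ t ∈ range (2 * n), f t = ∑ u ∈ range n, f (2 * u) + ∑ u ∈ range n, f (2 * u + 1) := by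
  induction n with
  | zero => simp
  | succ n ih =>
    rw [show 2 * (n + 1) = 2 * n + 1 + 1 by ring, sum_range_succ, sum_range_succ, ih,
      sum_range_succ, sum_range_succ]
    abel

/-- The part of `T_{2n}` coming from the odd columns. -/
noncomputable def oddPart (n : ℕ) : Polynomial ℝ :=
  ∑ u ∈ range n, (Polynomial.X : Polynomial ℝ) ^ carries (2 * u + 1) (2 * (n - 1 - u) + 1)

theorem T_double (n : ℕ) : T 2 (2 * n) = T 2 n + oddPart n := by
  rw [T_eq_sum_carries, sum_range_succ, sum_range_double, T_eq_sum_carries, sum_range_succ,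
    oddPart]
  have h1 : ∀ u ∈ range n, (Polynomial.X : Polynomial ℝ) ^ carries (2 * u) (2 * n - 2 * u) =
      Polynomial.X ^ carries u (n - u) := fun u _ => by
    rw [← Nat.mul_sub, carries_double_double]
  have h2 : ∀ u ∈ range n,
      (Polynomial.X : Polynomial ℝ) ^ carries (2 * u + 1) (2 * n - (2 * u + 1)) =
      Polynomial.X ^ carries (2 * u + 1) (2 * (n - 1 - u) + 1) := fun u hu => by
    rw [mem_range] at hu
    rw [show 2 * n - (2 * u + 1) = 2 * (n - 1 - u) + 1 by omega]
  rw [sum_congr rfl h1, sum_congr rfl h2]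
  simp only [← Nat.mul_sub, carries_double_double]
  ring

theorem T_odd (n : ℕ) : T 2 (2 * n + 1) = 2 * T 2 n := by
  rw [T_eq_sum_carries, show 2 * n + 1 + 1 = 2 * (n + 1) by ring, sum_range_double,
    T_eq_sum_carries, two_mul (Finset.sum _ _)]
  congr 1 <;> refine sum_congr (M := Polynomial ℝ) rfl fun u hu => ?_ <;> rw [mem_range] at hu
  · rw [show 2 * n + 1 - 2 * u = 2 * (n - u) + 1 by omega, carries_double_odd]
  · rw [show 2 * n + 1 - (2 * u + 1) = 2 * (n - u) by omega, carries_odd_double]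

theorem oddPart_odd (n : ℕ) : oddPart (2 * n + 1) = Polynomial.X * T 2 (2 * n) := by
  rw [oddPart, T_eq_sum_carries, mul_sum]
  refine sum_congr rfl fun u hu => ?_
  rw [mem_range] at hu
  rw [carries_odd_odd_of_even (n := n) (by omega), pow_succ',
    show 2 * n + 1 - 1 - u = 2 * n - u by omega]

/-- Here `u` and `2n - 1 - u` have opposite parity, so the summands end in `01` and `11` in some
order; deleting one digit from each removes exactly one carry. Each parity of `u` contributes one
copy. -/
theorem oddPart_double (n : ℕ) : oddPart (2 * n) = 2 * Polynomial.X * oddPart n := by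
  rw [oddPart, sum_range_double, mul_assoc, oddPart, mul_sum, two_mul (Finset.sum _ _)]
  congr 1 <;> refine sum_congr (M := Polynomial ℝ) rfl fun u hu => ?_ <;> rw [mem_range] at hu
  · rw [← pow_succ', ← carries_four_add_one_three]
    congr 2 <;> omega
  · rw [← pow_succ', ← carries_four_add_three_one]
    congr 2 <;> omega

theorem T_four_add_two (n : ℕ) :
    T 2 (2 * (2 * n + 1)) = 2 * T 2 n + Polynomial.X * T 2 (2 * n) := by
  rw [T_double, T_odd, oddPart_odd]

theorem T_four (n : ℕ) :
    T 2 (2 * (2 * n)) = T 2 (2 * n) + 2 * Polynomial.X * (T 2 (2 * n) - T 2 n) := by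
  rw [T_double (2 * n), oddPart_double, T_double n]; ring

theorem T_zero : T 2 0 = 1 := by simp [T]

theorem coeff_T (n j : ℕ) : (T 2 n).coeff j = theta 2 j n := by
  simp only [T, Polynomial.finsetSum_coeff, Polynomial.coeff_X_pow, theta, card_filter,
    Nat.cast_sum, eq_comm (a := j)]
  simp

theorem theta_pos (n : ℕ) : 0 < theta 2 0 n :=
  card_pos.2 ⟨0, by simp⟩

theorem theta_odd (n : ℕ) : theta 2 0 (2 * n + 1) = 2 * theta 2 0 n := by
  have := congrArg (Polynomial.coeff · 0) (T_odd n)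
  simp only [coeff_T, ← Polynomial.C_ofNat, Polynomial.coeff_C_mul] at this
  exact_mod_cast this

theorem theta_four_add_two (n : ℕ) : theta 2 0 (2 * (2 * n + 1)) = 2 * theta 2 0 n := by
  have := congrArg (Polynomial.coeff · 0) (T_four_add_two n)
  simp only [Polynomial.coeff_add, Polynomial.coeff_X_mul_zero, coeff_T, ← Polynomial.C_ofNat,
    Polynomial.coeff_C_mul] at this
  exact_mod_cast this.trans (add_zero _)

theorem theta_four (n : ℕ) : theta 2 0 (2 * (2 * n)) = theta 2 0 (2 * n) := by
  have := congrArg (Polynomial.coeff · 0) (T_four n)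
  simp only [Polynomial.coeff_add, coeff_T, mul_assoc, ← Polynomial.C_ofNat,
    Polynomial.coeff_C_mul, Polynomial.coeff_X_mul_zero, mul_zero, add_zero] at this
  exact_mod_cast this

theorem theta_double (n : ℕ) : theta 2 0 (2 * n) = theta 2 0 n := by
  induction n using Nat.strong_induction_on with
  | _ n ih =>
    rcases Nat.even_or_odd' n with ⟨m, rfl | rfl⟩
    · exact theta_four m
    · rw [theta_four_add_two, theta_odd]

theorem Tbar_odd (n : ℕ) : Tbar 2 (2 * n + 1) = Tbar 2 n := by
  have h : (theta 2 0 n : ℝ) ≠ 0 := by exact_mod_cast (theta_pos n).ne'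
  rw [Tbar, Tbar, T_odd, theta_odd, ← Polynomial.C_ofNat, ← mul_assoc, ← Polynomial.C_mul]
  congr 2
  push_cast
  field_simp

theorem Tbar_four_add_two (n : ℕ) :
    Tbar 2 (2 * (2 * n + 1)) = Tbar 2 n + Polynomial.C (1 / 2) * Polynomial.X * Tbar 2 (2 * n) := by
  have h : (theta 2 0 n : ℝ) ≠ 0 := by exact_mod_cast (theta_pos n).ne'
  have e : ((theta 2 0 n : ℝ))⁻¹ = (2 * (theta 2 0 n : ℝ))⁻¹ * 2 := by field_simp
  have e' : (2 * (theta 2 0 n : ℝ))⁻¹ = (1 / 2) * ((theta 2 0 n : ℝ))⁻¹ := by field_simp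
  rw [Tbar, Tbar, Tbar, T_four_add_two, theta_four_add_two, theta_double, mul_add]
  push_cast
  congr 1
  · rw [e, Polynomial.C_mul, Polynomial.C_ofNat]; ring
  · rw [e', Polynomial.C_mul]; ring

theorem Tbar_four (n : ℕ) :
    Tbar 2 (2 * (2 * n)) =
      Tbar 2 (2 * n) + 2 * Polynomial.X * (Tbar 2 (2 * n) - Tbar 2 n) := by
  rw [Tbar, Tbar, Tbar, T_four, theta_four, theta_double]; ring

theorem Tbar_zero : Tbar 2 0 = 1 := by
  have h : theta 2 0 0 = 1 := by
    have := coeff_T 0 0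
    rw [T_zero, Polynomial.coeff_one_zero] at this
    exact_mod_cast this.symm
  simp [Tbar, T_zero, h]

theorem coeff_Tbar (n j : ℕ) : (Tbar 2 n).coeff j = theta 2 j n / theta 2 0 n := by
  rw [Tbar, Polynomial.coeff_C_mul, coeff_T, div_eq_inv_mul]

theorem coeff_zero_Tbar (n : ℕ) : (Tbar 2 n).coeff 0 = 1 := by
  rw [coeff_Tbar, div_self (by exact_mod_cast (theta_pos n).ne')]

end PascalRows

namespace PascalRows

open Finset PowerSeries

/-! ### Quotients of row polynomials as power series -/

/-- The normalized row polynomial as a power series. -/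
noncomputable def rowSeries (n : ℕ) : ℝ⟦X⟧ := (Tbar 2 n : ℝ⟦X⟧)

/-- The quotient of the normalized row polynomials with indices `2n` and `n`. -/
noncomputable def ratioSeries (n : ℕ) : ℝ⟦X⟧ := rowSeries (2 * n) * (rowSeries n)⁻¹

theorem constantCoeff_rowSeries (n : ℕ) : constantCoeff (rowSeries n) = 1 := by
  rw [rowSeries, ← coeff_zero_eq_constantCoeff_apply, Polynomial.coeff_coe, coeff_zero_Tbar]

theorem constantCoeff_ratioSeries (n : ℕ) : constantCoeff (ratioSeries n) = 1 := by
  rw [ratioSeries, map_mul, constantCoeff_inv, constantCoeff_rowSeries, constantCoeff_rowSeries]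
  norm_num

theorem rowSeries_mul_inv (n : ℕ) : rowSeries n * (rowSeries n)⁻¹ = 1 :=
  PowerSeries.mul_inv_cancel _ (by rw [constantCoeff_rowSeries]; exact one_ne_zero)

theorem ratioSeries_mul_inv (n : ℕ) : ratioSeries n * (ratioSeries n)⁻¹ = 1 :=
  PowerSeries.mul_inv_cancel _ (by rw [constantCoeff_ratioSeries]; exact one_ne_zero)

theorem rowSeries_zero : rowSeries 0 = 1 := by simp [rowSeries, Tbar_zero]

theorem rowSeries_odd (n : ℕ) : rowSeries (2 * n + 1) = rowSeries n := by
  rw [rowSeries, Tbar_odd, rowSeries]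

theorem rowSeries_double (n : ℕ) : rowSeries (2 * n) = rowSeries n * ratioSeries n := by
  rw [ratioSeries]; linear_combination (- rowSeries (2 * n)) * rowSeries_mul_inv n

theorem ratioSeries_odd (n : ℕ) :
    ratioSeries (2 * n + 1) = 1 + C (1 / 2 : ℝ) * X * ratioSeries n := by
  have h : rowSeries (2 * (2 * n + 1)) =
      rowSeries n + C (1 / 2 : ℝ) * X * rowSeries (2 * n) := by
    rw [rowSeries, Tbar_four_add_two]; simp [rowSeries]
  rw [ratioSeries, rowSeries_odd, h, ratioSeries]
  linear_combination rowSeries_mul_inv n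

theorem ratioSeries_double (n : ℕ) :
    ratioSeries (2 * n) = 1 + 2 * X * (1 - (ratioSeries n)⁻¹) := by
  have h : rowSeries (2 * (2 * n)) =
      rowSeries (2 * n) + 2 * X * (rowSeries (2 * n) - rowSeries n) := by
    have e : ((2 : Polynomial ℝ) : ℝ⟦X⟧) = 2 := by
      rw [← Polynomial.C_ofNat, Polynomial.coe_C]; rfl
    rw [rowSeries, Tbar_four]; simp [rowSeries, e]
  have h2 := rowSeries_mul_inv (2 * n)
  have h1 := ratioSeries_mul_inv n
  rw [ratioSeries, h]
  have h3 : rowSeries n * (rowSeries (2 * n))⁻¹ = (ratioSeries n)⁻¹ := by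
    rw [rowSeries_double] at h2 ⊢
    linear_combination (- rowSeries n * (rowSeries n * ratioSeries n)⁻¹) * h1 +
      (ratioSeries n)⁻¹ * h2
  linear_combination (1 + 2 * X) * h2 - 2 * X * h3

/-- In both recurrences the previous quotient enters with a factor `X`, so each further common low
digit gains one order of agreement. -/
theorem X_pow_dvd_ratioSeries_sub (a : ℕ) : ∀ {m n : ℕ}, m % 2 ^ a = n % 2 ^ a →
    (X : ℝ⟦X⟧) ^ (a + 1) ∣ ratioSeries m - ratioSeries n := by
  induction a with
  | zero =>
    intro m n _
    rw [zero_add, pow_one, X_dvd_iff, map_sub, constantCoeff_ratioSeries,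
      constantCoeff_ratioSeries, sub_self]
  | succ a ih =>
    intro m n h
    have hm : m % 2 ^ (a + 1) % 2 = m % 2 := Nat.mod_mod_of_dvd _ (dvd_pow_self 2 (by omega))
    have hn : n % 2 ^ (a + 1) % 2 = n % 2 := Nat.mod_mod_of_dvd _ (dvd_pow_self 2 (by omega))
    have hd : m / 2 % 2 ^ a = n / 2 % 2 ^ a := by
      have := congrArg (· / 2) h
      simp only [pow_succ', Nat.mod_mul_right_div_self] at this
      exact this
    obtain ⟨g, hg⟩ := ih hd
    have hpar : m % 2 = n % 2 := by rw [← hm, ← hn, h]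
    rcases Nat.mod_two_eq_zero_or_one m with h0 | h1
    · rw [show m = 2 * (m / 2) by omega, show n = 2 * (n / 2) by omega, ratioSeries_double,
        ratioSeries_double]
      have h1 := ratioSeries_mul_inv (m / 2)
      have h2 := ratioSeries_mul_inv (n / 2)
      refine ⟨2 * g * (ratioSeries (m / 2))⁻¹ * (ratioSeries (n / 2))⁻¹, ?_⟩
      have h3 : (ratioSeries (n / 2))⁻¹ - (ratioSeries (m / 2))⁻¹ =
          X ^ (a + 1) * g * (ratioSeries (m / 2))⁻¹ * (ratioSeries (n / 2))⁻¹ := by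
        rw [← hg]
        linear_combination (- (ratioSeries (n / 2))⁻¹) * h1 + (ratioSeries (m / 2))⁻¹ * h2
      linear_combination 2 * X * h3
    · rw [show m = 2 * (m / 2) + 1 by omega, show n = 2 * (n / 2) + 1 by omega, ratioSeries_odd,
        ratioSeries_odd]
      exact ⟨C (1 / 2 : ℝ) * g, by linear_combination C (1 / 2 : ℝ) * X * hg⟩

/-! ### Logarithmic derivatives and the factorization over words -/

/-- The logarithmic derivative of a power series with nonzero constant coefficient. -/
noncomputable def dlog (f : ℝ⟦X⟧) : ℝ⟦X⟧ := derivative ℝ f * f⁻¹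

theorem dlog_mul {f g : ℝ⟦X⟧} (hf : constantCoeff f ≠ 0) (hg : constantCoeff g ≠ 0) :
    dlog (f * g) = dlog f + dlog g := by
  have h1 := PowerSeries.mul_inv_cancel f hf
  have h2 := PowerSeries.mul_inv_cancel g hg
  rw [dlog, dlog, dlog, Derivation.leibniz, PowerSeries.mul_inv_rev, smul_eq_mul, smul_eq_mul]
  linear_combination (derivative ℝ g * g⁻¹) * h1 + (derivative ℝ f * f⁻¹) * h2

theorem dlog_one : dlog 1 = 0 := by
  rw [dlog, ← map_one (C (R := ℝ)), derivative_C, zero_mul]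

theorem derivative_eq_dlog_mul {f : ℝ⟦X⟧} (hf : constantCoeff f ≠ 0) :
    derivative ℝ f = dlog f * f := by
  rw [dlog, mul_assoc, PowerSeries.inv_mul_cancel f hf, mul_one]

theorem X_pow_dvd_derivative {a : ℕ} {f : ℝ⟦X⟧} (h : X ^ (a + 1) ∣ f) :
    X ^ a ∣ derivative ℝ f := by
  rw [X_pow_dvd_iff] at h ⊢
  intro m hm
  rw [coeff_derivative, h (m + 1) (by omega), zero_mul]

theorem X_pow_dvd_dlog_sub {a : ℕ} {f g : ℝ⟦X⟧} (hf : constantCoeff f ≠ 0)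
    (hg : constantCoeff g ≠ 0) (h : X ^ (a + 1) ∣ f - g) : X ^ a ∣ dlog f - dlog g := by
  have h1 := PowerSeries.mul_inv_cancel f hf
  have h2 := PowerSeries.mul_inv_cancel g hg
  obtain ⟨u, hu⟩ := X_pow_dvd_derivative h
  obtain ⟨v, hv⟩ := (pow_dvd_pow (X : ℝ⟦X⟧) a.le_succ).trans h
  rw [map_sub] at hu
  refine ⟨(u * g - derivative ℝ g * v) * f⁻¹ * g⁻¹, ?_⟩
  rw [dlog, dlog]
  linear_combination (f⁻¹ * g⁻¹ * g) * hu - (derivative ℝ g * f⁻¹ * g⁻¹) * hv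
    - (derivative ℝ f * f⁻¹) * h2 + (derivative ℝ g * g⁻¹) * h1

/-- The logarithmic derivative of `T̄_{2n} / T̄_n`. -/
noncomputable def ratioDlog (n : ℕ) : ℝ⟦X⟧ := dlog (ratioSeries n)

/-- The integer obtained from `M` by deleting its leading binary digit. -/
def dropTop (M : ℕ) : ℕ := M % 2 ^ Nat.log 2 M

/-- The logarithmic derivative of `r_w`, where `w` is the binary expansion of `2M`. -/
noncomputable def wordDlog (M : ℕ) : ℝ⟦X⟧ := ratioDlog M - ratioDlog (dropTop M)

theorem coeff_ratioDlog_congr {a i m n : ℕ} (hi : i < a) (h : m % 2 ^ a = n % 2 ^ a) :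
    coeff i (ratioDlog m) = coeff i (ratioDlog n) := by
  have := X_pow_dvd_dlog_sub (by rw [constantCoeff_ratioSeries]; exact one_ne_zero)
    (by rw [constantCoeff_ratioSeries]; exact one_ne_zero) (X_pow_dvd_ratioSeries_sub a h)
  rw [X_pow_dvd_iff] at this
  simpa [sub_eq_zero, ratioDlog] using this i hi

/-- `M` and `dropTop M` agree in all digits below the leading one. This leaves finitely many words
in each degree, which is why the representing objects are polynomials. -/
theorem coeff_wordDlog_eq_zero {i M : ℕ} (h : 2 ^ (i + 1) ≤ M) : coeff i (wordDlog M) = 0 := by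
  have hM : M ≠ 0 := by have := Nat.two_pow_pos (i + 1); omega
  have : i < Nat.log 2 M := (Nat.le_log_iff_pow_le (by norm_num) hM).2 h
  rw [wordDlog, map_sub, sub_eq_zero]
  exact coeff_ratioDlog_congr this (by rw [dropTop, Nat.mod_mod])

theorem ratioDlog_zero : ratioDlog 0 = 0 := by
  rw [ratioDlog, ratioSeries, mul_zero, rowSeries_mul_inv, dlog_one]

/-- The binary expansion of `M` is a suffix of the (padded) binary expansion of `n`. -/
def EndsWith (M n : ℕ) : Prop := n % 2 ^ (Nat.log 2 M + 1) = M

instance (M n : ℕ) : Decidable (EndsWith M n) := inferInstanceAs (Decidable (_ = _))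

/-- The sum telescopes over suffix lengths: at length `B + 1` only the suffix `n % 2 ^ (B + 1)` can
contribute, and it does so exactly when its leading digit is 1. -/
theorem sum_wordDlog (n B : ℕ) :
    ∑ M ∈ Ico 1 (2 ^ B), (if EndsWith M n then wordDlog M else 0) = ratioDlog (n % 2 ^ B) := by
  induction B with
  | zero => simp [ratioDlog_zero, Nat.mod_one]
  | succ B ih =>
    rw [← sum_Ico_consecutive _ (Nat.one_le_two_pow (n := B))
      (Nat.pow_le_pow_right (by norm_num) B.le_succ), ih]
    have hlog : ∀ M ∈ Ico (2 ^ B) (2 ^ (B + 1)), Nat.log 2 M = B := fun M hM => by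
      rw [mem_Ico] at hM
      exact Nat.log_eq_of_pow_le_of_lt_pow hM.1 hM.2
    have e : ∀ M ∈ Ico (2 ^ B) (2 ^ (B + 1)), (if EndsWith M n then wordDlog M else 0) =
        if n % 2 ^ (B + 1) = M then ratioDlog (n % 2 ^ (B + 1)) - ratioDlog (n % 2 ^ B) else 0 := by
      intro M hM
      simp only [EndsWith, hlog M hM]
      split_ifs with h
      · rw [wordDlog, dropTop, hlog M hM, ← h, Nat.mod_mod_of_dvd _ (pow_dvd_pow 2 B.le_succ)]
      · rfl
    rw [sum_congr rfl e, sum_ite_eq]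
    split_ifs with h
    · ring
    -- Digit `B` of `n` is 0, so lengthening the suffix does not change its value.
    · have hlt : n % 2 ^ (B + 1) < 2 ^ (B + 1) := Nat.mod_lt _ (Nat.two_pow_pos _)
      rw [mem_Ico, not_and] at h
      have h2 : n % 2 ^ (B + 1) < 2 ^ B := by by_contra hc; exact h (by omega) hlt
      rw [add_zero, ← Nat.mod_mod_of_dvd n (pow_dvd_pow 2 B.le_succ), Nat.mod_eq_of_lt h2]

theorem coeff_ratioDlog (i n : ℕ) :
    coeff i (ratioDlog n) =
      ∑ M ∈ Ico 1 (2 ^ (i + 1)), (if EndsWith M n then coeff i (wordDlog M) else 0) := by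
  rw [coeff_ratioDlog_congr (n := n % 2 ^ (i + 1)) i.lt_succ_self (by rw [Nat.mod_mod]),
    ← sum_wordDlog, map_sum]
  exact sum_congr rfl fun M _ => by split_ifs <;> simp

/-- The number of occurrences of the word `binary(M) 0` in `n`, computed recursively. -/
def suffixCount (M : ℕ) (n : ℕ) : ℕ :=
  if h : n = 0 then 0
  else suffixCount M (n / 2) + if n % 2 = 0 ∧ EndsWith M (n / 2) then 1 else 0
termination_by n
decreasing_by omega

theorem suffixCount_zero (M : ℕ) : suffixCount M 0 = 0 := by rw [suffixCount]; simp

theorem suffixCount_odd (M n : ℕ) : suffixCount M (2 * n + 1) = suffixCount M n := by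
  rw [suffixCount, dif_neg (by omega), show (2 * n + 1) / 2 = n by omega, if_neg (by omega),
    add_zero]

theorem suffixCount_double {M : ℕ} (hM : 1 ≤ M) (n : ℕ) :
    suffixCount M (2 * n) = suffixCount M n + if EndsWith M n then 1 else 0 := by
  rcases Nat.eq_zero_or_pos n with rfl | hn
  · rw [mul_zero, suffixCount_zero, zero_add, if_neg (by rw [EndsWith, Nat.zero_mod]; omega)]
  · rw [suffixCount, dif_neg (by omega), show (2 * n) / 2 = n by omega]
    simp

/-- The logarithmic form of `T̄_n = ∏_w r_w ^ |n|_w`: a final digit 1 changes nothing, while a final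
0 after `m` adds `ratioDlog m`, the sum of `wordDlog` over the suffixes of `m`. -/
theorem coeff_dlog_rowSeries (i n : ℕ) :
    coeff i (dlog (rowSeries n)) =
      ∑ M ∈ Ico 1 (2 ^ (i + 1)), coeff i (wordDlog M) * suffixCount M n := by
  induction n using Nat.strong_induction_on with
  | _ n ih =>
    rcases Nat.eq_zero_or_pos n with rfl | hn
    · simp [rowSeries_zero, dlog_one, suffixCount_zero]
    rcases Nat.even_or_odd' n with ⟨m, rfl | rfl⟩
    · rw [rowSeries_double, dlog_mul (by rw [constantCoeff_rowSeries]; exact one_ne_zero)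
        (by rw [constantCoeff_ratioSeries]; exact one_ne_zero), map_add, ih m (by omega),
        ← ratioDlog, coeff_ratioDlog, ← sum_add_distrib]
      refine sum_congr rfl fun M hM => ?_
      rw [suffixCount_double (mem_Ico.1 hM).1]
      split_ifs <;> push_cast <;> ring
    · rw [rowSeries_odd, ih m (by omega)]
      simp only [suffixCount_odd]

end PascalRows

namespace PascalRows

open Finset

/-! ### Factor counts and the representing polynomials -/

theorem wordValue_digits (N : ℕ) : wordValue 2 (Nat.digits 2 N).reverse = N := by
  rw [wordValue, List.reverse_reverse, Nat.ofDigits_digits]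

theorem admissible_digits {M : ℕ} (hM : 1 ≤ M) :
    Admissible 2 (Nat.digits 2 (2 * M)).reverse := by
  have hd : Nat.digits 2 (2 * M) = 0 :: Nat.digits 2 M := by
    simpa using Nat.digits_add 2 (by norm_num) 0 M (by norm_num) (Or.inr (by omega))
  have hne : Nat.digits 2 M ≠ [] := Nat.digits_ne_nil_iff_ne_zero.2 (by omega)
  refine ⟨?_, fun a ha => Nat.digits_lt_base (by norm_num) (List.mem_reverse.1 ha), ?_, ?_⟩
  · rw [List.length_reverse, hd, List.length_cons]
    have := List.length_pos_iff.2 hne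
    omega
  · rw [List.head?_reverse, List.getLast?_eq_getLast_of_ne_nil (by rw [hd]; simp)]
    simpa using Nat.getLast_digit_ne_zero 2 (m := 2 * M) (by omega)
  · rw [List.getLast?_reverse, hd]; simp

/-- The admissible word `binary(M) 0`. -/
noncomputable def wordOf (M : ℕ) : AdmissibleWord 2 :=
  -- The maximum only supplies a default, the word `10`, at `M = 0`.
  ⟨(Nat.digits 2 (2 * max M 1)).reverse, admissible_digits (le_max_right _ _)⟩

theorem digits_wordValue {w : List ℕ} (hw : Admissible 2 w) :
    Nat.digits 2 (wordValue 2 w) = w.reverse := by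
  refine Nat.digits_ofDigits 2 (by norm_num) _ (fun a ha => hw.2.1 a (List.mem_reverse.1 ha)) ?_
  intro h h0
  rw [List.getLast_reverse] at h0
  apply hw.2.2.1
  rw [← h0, List.head?_eq_some_head]

theorem two_dvd_wordValue {w : List ℕ} (hw : Admissible 2 w) : 2 ∣ wordValue 2 w := by
  have hne : w ≠ [] := by rintro rfl; simpa using hw.1
  have h1 : w.getLast hne ≠ 1 := by
    intro h; apply hw.2.2.2; rw [List.getLast?_eq_getLast_of_ne_nil hne, h]
  have h2 := hw.2.1 _ (List.getLast_mem hne)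
  have h3 : w.reverse = w.getLast hne :: w.dropLast.reverse := by
    conv_lhs => rw [← List.dropLast_append_getLast hne]
    simp
  rw [wordValue, h3, Nat.ofDigits_cons, show w.getLast hne = 0 by omega]
  simp

theorem one_le_wordValue_half {w : List ℕ} (hw : Admissible 2 w) : 1 ≤ wordValue 2 w / 2 := by
  have h2 := two_dvd_wordValue hw
  have : wordValue 2 w ≠ 0 := by
    intro h
    have := digits_wordValue hw
    rw [h, Nat.digits_zero] at this
    have h1 := hw.1
    rw [← List.length_reverse, ← this] at h1
    simp at h1
  omega

theorem wordOf_wordValue (w : AdmissibleWord 2) : wordOf (wordValue 2 w.1 / 2) = w := by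
  apply Subtype.ext
  have h1 := one_le_wordValue_half w.2
  change (Nat.digits 2 (2 * max (wordValue 2 w.1 / 2) 1)).reverse = w.1
  rw [max_eq_left h1, Nat.mul_div_cancel' (two_dvd_wordValue w.2), digits_wordValue w.2,
    List.reverse_reverse]

theorem wordValue_wordOf {M : ℕ} (hM : 1 ≤ M) : wordValue 2 (wordOf M).1 = 2 * M := by
  rw [wordOf, wordValue_digits, max_eq_left hM]

theorem wordOf_injOn {M N : ℕ} (hM : 1 ≤ M) (hN : 1 ≤ N) (h : wordOf M = wordOf N) : M = N := by
  have := wordValue_wordOf hM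
  rw [h, wordValue_wordOf hN] at this
  omega

/-- The set of positions at which the word `binary(M) 0` occurs in `n`. -/
def positions (M n : ℕ) : Set ℕ := {i | n / 2 ^ i % 2 ^ (Nat.log 2 M + 2) = 2 * M}

theorem factorCount_wordOf_eq_ncard {M : ℕ} (hM : 1 ≤ M) (n : ℕ) :
    factorCount 2 (wordOf M).1 n = (positions M n).ncard := by
  rw [factorCount, positions]
  congr 1
  ext i
  have hlen : (Nat.digits 2 (2 * M)).length = Nat.log 2 M + 2 := by
    rw [Nat.length_digits 2 _ (by norm_num) (by omega), mul_comm, Nat.log_mul_base (by norm_num) (by omega)]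
  have hlt : 2 * M < 2 ^ (Nat.log 2 M + 2) := by
    have := Nat.lt_pow_succ_log_self (b := 2) (by norm_num) M
    rw [pow_succ]; omega
  simp only [Set.mem_ofPred_eq, wordOf, max_eq_left hM, List.length_reverse, List.reverse_reverse,
    hlen, Nat.getD_digits _ _ (le_refl 2)]
  constructor
  · intro h
    apply Nat.eq_of_testBit_eq
    intro m
    rw [Nat.testBit_mod_two_pow]
    by_cases hm : m < Nat.log 2 M + 2
    · have := h m hm
      rw [pow_add, ← Nat.div_div_eq_div_mul] at this
      simp [hm, Nat.testBit_eq_decide_div_mod_eq, this]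
    · have h2 : (2 * M).testBit m = false :=
        Nat.testBit_lt_two_pow (hlt.trans_le (Nat.pow_le_pow_right (by norm_num) (by omega)))
      rw [h2]; simp [hm]
  · intro h m hm
    have h1 := congrArg (Nat.testBit · m) h
    simp only [Nat.testBit_mod_two_pow, hm, decide_true, Bool.true_and] at h1
    rw [pow_add, ← Nat.div_div_eq_div_mul]
    simp only [Nat.testBit_eq_decide_div_mod_eq, decide_eq_decide] at h1
    omega

theorem positions_zero {M : ℕ} (hM : 1 ≤ M) : positions M 0 = ∅ := by
  ext i; simp [positions]; omega

theorem mem_positions_succ (M n i : ℕ) : i + 1 ∈ positions M n ↔ i ∈ positions M (n / 2) := by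
  rw [positions, positions, Set.mem_ofPred_eq, Set.mem_ofPred_eq, pow_succ',
    ← Nat.div_div_eq_div_mul]

theorem zero_mem_positions (M n : ℕ) : 0 ∈ positions M n ↔ n % 2 = 0 ∧ EndsWith M (n / 2) := by
  rw [positions, Set.mem_ofPred_eq, pow_zero, Nat.div_one, EndsWith, pow_succ', Nat.mod_mul]
  omega

theorem suffixCount_eq_ncard {M : ℕ} (hM : 1 ≤ M) (n : ℕ) :
    (positions M n).Finite ∧ (positions M n).ncard = suffixCount M n := by
  induction n using Nat.strong_induction_on with
  | _ n ih =>
    rcases Nat.eq_zero_or_pos n with rfl | hn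
    · simp [positions_zero hM, suffixCount_zero]
    obtain ⟨hf, hc⟩ := ih (n / 2) (by omega)
    rw [suffixCount, dif_neg (by omega)]
    have himg : (Nat.succ '' positions M (n / 2)).ncard = suffixCount M (n / 2) := by
      rw [Set.ncard_image_of_injective _ Nat.succ_injective, hc]
    by_cases h0 : n % 2 = 0 ∧ EndsWith M (n / 2)
    · have he : positions M n = insert 0 (Nat.succ '' positions M (n / 2)) := by
        ext i
        rcases i with _ | i
        · simp [zero_mem_positions, h0]
        · simp [mem_positions_succ]
      rw [if_pos h0, he]
      refine ⟨(hf.image _).insert _, ?_⟩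
      rw [Set.ncard_insert_of_notMem (by simp) (hf.image _), himg]
    · have he : positions M n = Nat.succ '' positions M (n / 2) := by
        ext i
        rcases i with _ | i
        · simpa [zero_mem_positions] using h0
        · simp [mem_positions_succ]
      rw [if_neg h0, he]
      exact ⟨hf.image _, himg⟩

theorem factorCount_wordOf {M : ℕ} (hM : 1 ≤ M) (n : ℕ) :
    factorCount 2 (wordOf M).1 n = suffixCount M n := by
  rw [factorCount_wordOf_eq_ncard hM, (suffixCount_eq_ncard hM n).2]

/-- The vector of factor counts of `n`. -/
noncomputable def counts (n : ℕ) (w : AdmissibleWord 2) : ℝ := factorCount 2 w.1 n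

/-- The coefficient of `x ^ i` in `∑_w X_w r_w' / r_w`. -/
noncomputable def dlogPoly (i : ℕ) : MvPolynomial (AdmissibleWord 2) ℝ :=
  ∑ M ∈ Ico 1 (2 ^ (i + 1)),
    MvPolynomial.C (PowerSeries.coeff i (wordDlog M)) * MvPolynomial.X (wordOf M)

theorem eval_dlogPoly (i n : ℕ) :
    MvPolynomial.eval (counts n) (dlogPoly i) = PowerSeries.coeff i (dlog (rowSeries n)) := by
  rw [dlogPoly, map_sum, coeff_dlog_rowSeries]
  refine sum_congr rfl fun M hM => ?_
  rw [map_mul, MvPolynomial.eval_C, MvPolynomial.eval_X, counts,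
    factorCount_wordOf (mem_Ico.1 hM).1]

/-- The coefficients of `∏_w r_w ^ X_w`, computed from its logarithmic derivative. -/
noncomputable def repPoly : ℕ → MvPolynomial (AdmissibleWord 2) ℝ
  | 0 => 1
  | j + 1 => MvPolynomial.C ((j + 1 : ℝ)⁻¹) * ∑ i : Fin (j + 1), dlogPoly (j - i) * repPoly i

theorem repPoly_succ (j : ℕ) :
    repPoly (j + 1) = MvPolynomial.C ((j + 1 : ℝ)⁻¹) *
      ∑ i ∈ range (j + 1), dlogPoly (j - i) * repPoly i := by
  rw [repPoly, Fin.sum_univ_eq_sum_range (fun i => dlogPoly (j - i) * repPoly i)]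

theorem coeff_succ_of_derivative {R : Type*} [CommSemiring R] {f g h : PowerSeries R}
    (H : PowerSeries.derivative R f = g * h) (j : ℕ) :
    PowerSeries.coeff (j + 1) f * (j + 1) =
      ∑ i ∈ range (j + 1), PowerSeries.coeff (j - i) g * PowerSeries.coeff i h := by
  rw [← PowerSeries.coeff_derivative, H, mul_comm, PowerSeries.coeff_mul,
    Nat.sum_antidiagonal_eq_sum_range_succ_mk]
  exact sum_congr rfl fun i _ => mul_comm _ _

theorem eval_repPoly (j n : ℕ) :
    MvPolynomial.eval (counts n) (repPoly j) = PowerSeries.coeff j (rowSeries n) := by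
  induction j using Nat.strong_induction_on with
  | _ j ih =>
    rcases j with _ | j
    · rw [repPoly, map_one, PowerSeries.coeff_zero_eq_constantCoeff_apply, constantCoeff_rowSeries]
    · have h := coeff_succ_of_derivative (derivative_eq_dlog_mul
        (by rw [constantCoeff_rowSeries]; exact one_ne_zero) : _ = _ * rowSeries n) j
      rw [repPoly_succ, map_mul, map_sum, MvPolynomial.eval_C,
        sum_congr rfl fun i hi => by rw [map_mul, eval_dlogPoly, ih i (by simpa using hi)], ← h]
      field_simp

theorem represents_repPoly (j : ℕ) : Represents 2 j (repPoly j) := by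
  intro n
  refine Eq.trans ?_ (eval_repPoly j n).symm
  rw [rowSeries, Polynomial.coeff_coe, coeff_Tbar]

end PascalRows

namespace PascalRows

open Finset

/-! ### Uniqueness of the representing polynomials -/

/-- On a line in a direction already treated, the polynomial vanishes at all natural multiples,
hence at all real ones. -/
theorem eval_eq_zero_of_mem_span {ι : Type*} (V : AddSubmonoid (ι → ℝ)) (q : MvPolynomial ι ℝ)
    (h : ∀ v ∈ V, MvPolynomial.eval v q = 0) {y : ι → ℝ}
    (hy : y ∈ Submodule.span ℝ (V : Set (ι → ℝ))) : MvPolynomial.eval y q = 0 := by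
  -- Quantifying over the base point `z` lets translations be composed, as the sum and multiple
  -- cases of the induction require.
  have key : ∀ z : ι → ℝ, (∀ v ∈ V, MvPolynomial.eval (z + v) q = 0) →
      ∀ v ∈ V, MvPolynomial.eval (z + y + v) q = 0 := by
    induction hy using Submodule.span_induction with
    | mem y hy => intro z hz v hv; rw [add_assoc]; exact hz _ (V.add_mem hy hv)
    | zero => simp
    | add y₁ y₂ _ _ h₁ h₂ => intro z hz; rw [← add_assoc]; exact h₂ _ (h₁ z hz)
    | smul c y _ ih =>
      intro z hz v hv
      have hn : ∀ n : ℕ, ∀ v ∈ V, MvPolynomial.eval (z + (n : ℝ) • y + v) q = 0 := by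
        intro n
        induction n with
        | zero => simpa using hz
        | succ n ihn =>
          have := ih _ ihn
          rw [Nat.cast_succ, add_smul, one_smul, ← add_assoc]
          exact this
      set r : Polynomial ℝ := MvPolynomial.eval₂ Polynomial.C
        (fun a => Polynomial.C (z a + v a) + Polynomial.X * Polynomial.C (y a)) q with hr
      have hev : ∀ t : ℝ, r.eval t = MvPolynomial.eval (z + t • y + v) q := by
        intro t
        rw [hr, ← Polynomial.coe_evalRingHom, MvPolynomial.hom_eval₂, MvPolynomial.eval,
          MvPolynomial.coe_eval₂Hom]
        congr 1
        · ext; simp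
        · ext a; simp; ring
      have h0 : r = 0 := by
        refine Polynomial.eq_zero_of_infinite_isRoot r
          ((Set.infinite_range_of_injective (Nat.cast_injective (R := ℝ))).mono ?_)
        rintro _ ⟨n, rfl⟩
        exact (hev n).trans (hn n v hv)
      rw [← hev c, h0, Polynomial.eval_zero]
  simpa using key 0 (by simpa using h) 0 V.zero_mem

theorem endsWith_congr {M L m n : ℕ} (hM : Nat.log 2 M + 1 ≤ L) (h : m % 2 ^ L = n % 2 ^ L) :
    EndsWith M m ↔ EndsWith M n := by
  rw [EndsWith, EndsWith, ← Nat.mod_mod_of_dvd m (pow_dvd_pow 2 hM), h,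
    Nat.mod_mod_of_dvd n (pow_dvd_pow 2 hM)]

/-- The `L` trailing zeros of `n` act like the zero padding of `m`: no occurrence, starting with 1,
can reach across them. -/
theorem suffixCount_concat {M L n : ℕ} (hM : 1 ≤ M) (hL : Nat.log 2 M + 1 ≤ L) (hn : 2 ^ L ∣ n)
    (K : ℕ) : ∀ {m : ℕ}, m < 2 ^ K →
      suffixCount M (n * 2 ^ K + m) = suffixCount M n + suffixCount M m := by
  induction K with
  | zero => intro m hm; rw [show m = 0 by simpa using hm]; simp [suffixCount_zero]
  | succ K ih =>
    intro m hm
    rw [pow_succ] at hm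
    rcases Nat.even_or_odd' m with ⟨u, rfl | rfl⟩
    · rw [show n * 2 ^ (K + 1) + 2 * u = 2 * (n * 2 ^ K + u) by ring, suffixCount_double hM,
        suffixCount_double hM, ih (by omega)]
      have : EndsWith M (n * 2 ^ K + u) ↔ EndsWith M u := endsWith_congr hL (by
        obtain ⟨c, rfl⟩ := hn
        rw [mul_assoc, Nat.mul_add_mod])
      simp only [this]
      ring
    · rw [show n * 2 ^ (K + 1) + (2 * u + 1) = 2 * (n * 2 ^ K + u) + 1 by ring, suffixCount_odd,
        suffixCount_odd, ih (by omega)]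

theorem suffixCount_mul_pow {M L c d : ℕ} (hM : 1 ≤ M) (hL : Nat.log 2 M + 1 ≤ L)
    (h : c % 2 ^ L = d % 2 ^ L) (j : ℕ) :
    suffixCount M (c * 2 ^ j) + suffixCount M d =
      suffixCount M (d * 2 ^ j) + suffixCount M c := by
  induction j with
  | zero => simp [add_comm]
  | succ j ih =>
    have : EndsWith M (c * 2 ^ j) ↔ EndsWith M (d * 2 ^ j) :=
      endsWith_congr hL (Nat.ModEq.mul_right _ h)
    rw [pow_succ', mul_left_comm, mul_left_comm d, suffixCount_double hM, suffixCount_double hM]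
    simp only [this]
    omega

theorem suffixCount_append_ones (M m j : ℕ) :
    suffixCount M (m * 2 ^ j + (2 ^ j - 1)) = suffixCount M m := by
  induction j with
  | zero => simp
  | succ j ih =>
    have := Nat.two_pow_pos j
    have e : m * 2 ^ (j + 1) + (2 ^ (j + 1) - 1) = 2 * (m * 2 ^ j + (2 ^ j - 1)) + 1 := by
      rw [pow_succ', mul_left_comm]
      omega
    rw [e, suffixCount_odd, ih]

/-- Linear independence of the counts, even on multiples of `2 ^ L`. Passing from counts to the
indicators `EndsWith` makes the system triangular. -/
theorem eq_zero_of_forall_sum_suffixCount {ι : Type*} [Fintype ι] {M : ι → ℕ}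
    (hinj : Function.Injective M) (hM : ∀ a, 1 ≤ M a) {L : ℕ} (hL : ∀ a, Nat.log 2 (M a) + 1 ≤ L)
    (c : ι → ℝ) (h : ∀ n : ℕ, ∑ a, c a * suffixCount (M a) (n * 2 ^ L) = 0) (a : ι) :
    c a = 0 := by
  -- Inserting the block `1^L` after `m` isolates it from the trailing zeros: these add a
  -- contribution independent of `m`, which the hypothesis at `2 ^ L - 1` kills.
  have h1 : ∀ m : ℕ, ∑ a, c a * suffixCount (M a) m = 0 := by
    intro m
    have e : ∀ a, suffixCount (M a) ((m * 2 ^ L + (2 ^ L - 1)) * 2 ^ L) =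
        suffixCount (M a) ((2 ^ L - 1) * 2 ^ L) + suffixCount (M a) m := by
      intro a
      have := suffixCount_mul_pow (hM a) (hL a) (c := m * 2 ^ L + (2 ^ L - 1)) (d := 2 ^ L - 1)
        (Nat.mul_add_mod' ..) L
      have h0 := suffixCount_append_ones (M a) 0 L
      rw [zero_mul, zero_add, suffixCount_zero] at h0
      rw [h0, suffixCount_append_ones] at this
      exact this
    have h2 := h (m * 2 ^ L + (2 ^ L - 1))
    simp only [e, Nat.cast_add, mul_add, sum_add_distrib] at h2
    rwa [h, zero_add] at h2
  have h2 : ∀ m : ℕ, ∑ a, c a * (if EndsWith (M a) m then 1 else 0) = 0 := by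
    intro m
    have := h1 (2 * m)
    simp only [suffixCount_double (hM _), Nat.cast_add, mul_add, sum_add_distrib] at this
    rw [h1, zero_add] at this
    simpa using this
  -- Testing at `m = M a` involves only suffixes of `M a`; all proper ones are smaller numbers.
  have key : ∀ N a, M a = N → c a = 0 := by
    intro N
    induction N using Nat.strong_induction_on with
    | _ N ih =>
      rintro a rfl
      have := h2 (M a)
      rw [sum_eq_single a] at this
      · rwa [if_pos, mul_one] at this
        exact Nat.mod_eq_of_lt (Nat.lt_pow_succ_log_self (by norm_num) _)
      · intro b _ hb
        by_cases he : EndsWith (M b) (M a)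
        · have hlt : M b < M a :=
            lt_of_le_of_ne (he ▸ Nat.mod_le _ _) fun h => hb (hinj h)
          rw [ih _ hlt b rfl, zero_mul]
        · rw [if_neg he, mul_zero]
      · simp
  exact key _ a rfl

theorem counts_eq_suffixCount (n : ℕ) (w : AdmissibleWord 2) :
    counts n w = suffixCount (wordValue 2 w.1 / 2) n := by
  conv_lhs => rw [← wordOf_wordValue w]
  rw [counts, factorCount_wordOf (one_le_wordValue_half w.2)]

theorem eq_zero_of_eval_counts (Q : MvPolynomial (AdmissibleWord 2) ℝ)
    (hQ : ∀ n, MvPolynomial.eval (counts n) Q = 0) : Q = 0 := by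
  obtain ⟨k, f, hf, q, rfl⟩ := MvPolynomial.exists_fin_rename Q
  simp only [MvPolynomial.eval_rename] at hQ
  set M : Fin k → ℕ := fun a => wordValue 2 (f a).1 / 2 with hMdef
  have hM : ∀ a, 1 ≤ M a := fun a => one_le_wordValue_half (f a).2
  have hinj : Function.Injective M := fun a b hab => hf (by
    rw [← wordOf_wordValue (f a), ← wordOf_wordValue (f b)]; exact congrArg wordOf hab)
  set L : ℕ := ∑ a, (Nat.log 2 (M a) + 1) with hLdef
  have hL : ∀ a, Nat.log 2 (M a) + 1 ≤ L := fun a =>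
    single_le_sum (f := fun a => Nat.log 2 (M a) + 1) (fun _ _ => Nat.zero_le _) (mem_univ a)
  have hv : ∀ n, counts n ∘ f = fun a => (suffixCount (M a) n : ℝ) := fun n =>
    funext fun a => counts_eq_suffixCount n (f a)
  simp only [hv] at hQ
  let V : AddSubmonoid (Fin k → ℝ) :=
    { carrier := Set.range fun (n : ℕ) (a : Fin k) => (suffixCount (M a) (n * 2 ^ L) : ℝ)
      zero_mem' := ⟨0, by ext a; simp [suffixCount_zero]⟩
      add_mem' := by
        rintro _ _ ⟨m, rfl⟩ ⟨n, rfl⟩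
        -- Concatenation realizes addition; the shift `n * 2 ^ L` is a crude bound for the digit
        -- length of `n * 2 ^ L` itself.
        refine ⟨m * 2 ^ (n * 2 ^ L) + n, funext fun a => ?_⟩
        have := suffixCount_concat (hM a) (hL a) (dvd_mul_left (2 ^ L) m) (n * 2 ^ L)
          (m := n * 2 ^ L) Nat.lt_two_pow_self
        rw [mul_right_comm, ← add_mul] at this
        simp [this] }
  have hspan : Submodule.span ℝ (V : Set (Fin k → ℝ)) = ⊤ := by
    by_contra hne
    obtain ⟨φ, hφ, hle⟩ := Submodule.exists_le_ker_of_lt_top _ (lt_top_iff_ne_top.2 hne)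
    apply hφ
    have hsum : ∀ y : Fin k → ℝ, φ y = ∑ a, φ (Pi.single a 1) * y a := by
      intro y
      conv_lhs => rw [pi_eq_sum_univ' y]
      simp [mul_comm]
    have hz := eq_zero_of_forall_sum_suffixCount hinj hM hL (fun a => φ (Pi.single a 1))
      fun n => by
        rw [← hsum fun a => (suffixCount (M a) (n * 2 ^ L) : ℝ)]
        exact hle (Submodule.subset_span ⟨n, rfl⟩)
    ext a
    simpa using hz a
  have h0 : q = 0 := MvPolynomial.funext fun y => by
    rw [map_zero]
    refine eval_eq_zero_of_mem_span V q ?_ (hspan ▸ Submodule.mem_top)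
    rintro _ ⟨n, rfl⟩
    exact hQ _
  rw [h0, map_zero]

theorem represents_iff (j : ℕ) (Q : MvPolynomial (AdmissibleWord 2) ℝ) :
    Represents 2 j Q ↔ Q = repPoly j := by
  refine ⟨fun h => ?_, fun h => h ▸ represents_repPoly j⟩
  rw [← sub_eq_zero]
  refine eq_zero_of_eval_counts _ fun n => ?_
  rw [map_sub, sub_eq_zero]
  exact (h n).symm.trans (represents_repPoly j n)

end PascalRows

namespace PascalRows

open Finset

/-! ### Power series formed by the coefficients of the representing polynomials -/

/-- The series `∑_j c_j x ^ j`, where `c_j` is the coefficient of `X_w ^ k` in the `j`-th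
representing polynomial and `w = binary(M) 0`. -/
noncomputable def powSeries (M k : ℕ) : PowerSeries ℝ :=
  PowerSeries.mk fun j => coeffPow (wordOf M) k (repPoly j)

theorem constantCoeff_powSeries (M k : ℕ) :
    PowerSeries.constantCoeff (powSeries M k) = if k = 0 then 1 else 0 := by
  rw [← PowerSeries.coeff_zero_eq_constantCoeff_apply, powSeries, PowerSeries.coeff_mk, coeffPow,
    repPoly, MvPolynomial.coeff_one]
  simp only [eq_comm (a := (0 : AdmissibleWord 2 →₀ ℕ)), Finsupp.single_eq_zero]

theorem coeffPow_zero_dlogPoly_mul (M i : ℕ) (p : MvPolynomial (AdmissibleWord 2) ℝ) :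
    coeffPow (wordOf M) 0 (dlogPoly i * p) = 0 := by
  rw [coeffPow, dlogPoly, sum_mul, MvPolynomial.coeff_sum]
  refine sum_eq_zero fun N _ => ?_
  rw [mul_assoc, MvPolynomial.coeff_C_mul, MvPolynomial.coeff_X_mul']
  simp

/-- Only the summand carrying the variable of `M` itself can produce a pure power of it. If `M` lies
outside the range of summation, its coefficient is zero anyway. -/
theorem coeffPow_succ_dlogPoly_mul {M : ℕ} (hM : 1 ≤ M) (k i : ℕ)
    (p : MvPolynomial (AdmissibleWord 2) ℝ) :
    coeffPow (wordOf M) (k + 1) (dlogPoly i * p) =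
      PowerSeries.coeff i (wordDlog M) * coeffPow (wordOf M) k p := by
  have e : ∀ N ∈ Ico 1 (2 ^ (i + 1)),
      MvPolynomial.coeff (Finsupp.single (wordOf M) (k + 1))
        (MvPolynomial.C (PowerSeries.coeff i (wordDlog N)) * MvPolynomial.X (wordOf N) * p) =
      if N = M then PowerSeries.coeff i (wordDlog M) * coeffPow (wordOf M) k p else 0 := by
    intro N hN
    rw [mul_assoc, MvPolynomial.coeff_C_mul, MvPolynomial.coeff_X_mul']
    simp only [Finsupp.mem_support_single, ne_eq, Nat.succ_ne_zero, not_false_eq_true, and_true]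
    by_cases h : N = M
    · subst h
      rw [if_pos rfl, if_pos rfl, ← Finsupp.single_tsub, Nat.add_sub_cancel, coeffPow]
    · rw [if_neg h, if_neg fun hw => h (wordOf_injOn (mem_Ico.1 hN).1 hM hw), mul_zero]
  rw [coeffPow, dlogPoly, sum_mul, MvPolynomial.coeff_sum, sum_congr rfl e, sum_ite_eq']
  split_ifs with h
  · rfl
  · rw [coeff_wordDlog_eq_zero (by rw [mem_Ico] at h; omega), zero_mul]

theorem coeffPow_repPoly_succ (w : AdmissibleWord 2) (k j : ℕ) :
    coeffPow w k (repPoly (j + 1)) * (j + 1) =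
      ∑ i ∈ range (j + 1), coeffPow w k (dlogPoly (j - i) * repPoly i) := by
  simp only [coeffPow, repPoly_succ, MvPolynomial.coeff_C_mul, MvPolynomial.coeff_sum]
  field_simp

theorem derivative_powSeries_zero (M : ℕ) : PowerSeries.derivative ℝ (powSeries M 0) = 0 := by
  ext j
  rw [PowerSeries.coeff_derivative, powSeries, PowerSeries.coeff_mk, coeffPow_repPoly_succ,
    map_zero]
  exact sum_eq_zero fun i _ => coeffPow_zero_dlogPoly_mul M _ _

theorem derivative_powSeries_succ {M : ℕ} (hM : 1 ≤ M) (k : ℕ) :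
    PowerSeries.derivative ℝ (powSeries M (k + 1)) = wordDlog M * powSeries M k := by
  ext j
  rw [PowerSeries.coeff_derivative, powSeries, PowerSeries.coeff_mk, coeffPow_repPoly_succ,
    mul_comm (wordDlog M), PowerSeries.coeff_mul, Nat.sum_antidiagonal_eq_sum_range_succ_mk]
  refine sum_congr rfl fun i _ => ?_
  rw [coeffPow_succ_dlogPoly_mul hM, powSeries, PowerSeries.coeff_mk, mul_comm]

/-- The numerator of `r_w` for `w = binary(M) 0`. -/
noncomputable def wordNum (M : ℕ) : Polynomial ℝ := Tbar 2 (2 * M) * Tbar 2 (dropTop M)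

/-- The denominator of `r_w` for `w = binary(M) 0`. -/
noncomputable def wordDen (M : ℕ) : Polynomial ℝ := Tbar 2 M * Tbar 2 (2 * dropTop M)

theorem wordDlog_mul (M : ℕ) :
    wordDlog M * ((wordNum M * wordDen M : Polynomial ℝ) : PowerSeries ℝ) =
      ((Polynomial.derivative (wordNum M) * wordDen M -
        wordNum M * Polynomial.derivative (wordDen M) : Polynomial ℝ) : PowerSeries ℝ) := by
  have hc : ∀ n, PowerSeries.constantCoeff (rowSeries n) ≠ 0 := fun n => by
    rw [constantCoeff_rowSeries]; exact one_ne_zero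
  have hq : ∀ n, ratioDlog n = dlog (rowSeries (2 * n)) - dlog (rowSeries n) := fun n => by
    rw [rowSeries_double, dlog_mul (hc n)
      (by rw [constantCoeff_ratioSeries]; exact one_ne_zero), ratioDlog]
    ring
  have h := fun n => derivative_eq_dlog_mul (hc n)
  rw [wordDlog, hq, hq]
  simp only [wordNum, wordDen, Polynomial.derivative_mul, Polynomial.coe_mul, Polynomial.coe_sub,
    Polynomial.coe_add, ← PowerSeries.derivative_coe]
  have hr : ∀ n, (Tbar 2 n : PowerSeries ℝ) = rowSeries n := fun _ => rfl
  simp only [hr, h]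
  ring

end PascalRows

namespace PascalRows

open Finset Complex

/-! ### Analytic continuation of the logarithm of a rational function -/

/-- The Taylor series at the origin. -/
noncomputable def taylorAtZero (f : ℂ → ℂ) : PowerSeries ℂ :=
  PowerSeries.mk fun n => iteratedDeriv n f 0 / (n.factorial : ℂ)

theorem taylorAtZero_mul {f g : ℂ → ℂ} (hf : AnalyticAt ℂ f 0) (hg : AnalyticAt ℂ g 0) :
    taylorAtZero (fun z => f z * g z) = taylorAtZero f * taylorAtZero g := by
  ext n
  rw [PowerSeries.coeff_mul, Nat.sum_antidiagonal_eq_sum_range_succ_mk]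
  simp only [taylorAtZero, PowerSeries.coeff_mk]
  rw [iteratedDeriv_fun_mul hf.contDiffAt hg.contDiffAt, sum_div]
  refine sum_congr rfl fun i hi => ?_
  have hi' : i ≤ n := by simpa [Nat.lt_succ_iff] using hi
  rw [Nat.cast_choose ℂ hi']
  have h1 := Nat.cast_ne_zero (R := ℂ).2 n.factorial_ne_zero
  have h2 := Nat.cast_ne_zero (R := ℂ).2 i.factorial_ne_zero
  have h3 := Nat.cast_ne_zero (R := ℂ).2 (n - i).factorial_ne_zero
  field_simp

theorem derivative_taylorAtZero (f : ℂ → ℂ) :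
    PowerSeries.derivative ℂ (taylorAtZero f) = taylorAtZero (deriv f) := by
  ext n
  rw [PowerSeries.coeff_derivative, taylorAtZero, taylorAtZero, PowerSeries.coeff_mk,
    PowerSeries.coeff_mk, iteratedDeriv_succ', Nat.factorial_succ]
  have h1 := Nat.cast_ne_zero (R := ℂ).2 n.factorial_ne_zero
  have h2 : (n : ℂ) + 1 ≠ 0 := Nat.cast_add_one_ne_zero n
  push_cast
  field_simp

theorem taylorAtZero_congr {f g : ℂ → ℂ} (h : f =ᶠ[nhds 0] g) :
    taylorAtZero f = taylorAtZero g := by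
  ext n
  rw [taylorAtZero, taylorAtZero, PowerSeries.coeff_mk, PowerSeries.coeff_mk,
    h.iteratedDeriv_eq n]

theorem constantCoeff_taylorAtZero (f : ℂ → ℂ) :
    PowerSeries.constantCoeff (taylorAtZero f) = f 0 := by
  rw [← PowerSeries.coeff_zero_eq_constantCoeff_apply, taylorAtZero, PowerSeries.coeff_mk]
  simp

theorem taylorAtZero_polynomial (p : Polynomial ℂ) :
    taylorAtZero (fun z => p.eval z) = (p : PowerSeries ℂ) := by
  have h : ∀ n, iteratedDeriv n (fun z => p.eval z) =
      fun z => (Polynomial.derivative^[n] p).eval z := by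
    intro n
    induction n with
    | zero => simp
    | succ n ih =>
      rw [iteratedDeriv_succ, ih, Function.iterate_succ_apply']
      ext z
      exact Polynomial.deriv _
  ext n
  rw [taylorAtZero, PowerSeries.coeff_mk, h]
  beta_reduce
  rw [← Polynomial.coeff_zero_eq_eval_zero,
    Polynomial.coeff_iterate_derivative, zero_add, Nat.descFactorial_self, Polynomial.coeff_coe,
    nsmul_eq_mul]
  exact mul_div_cancel_left₀ _ (Nat.cast_ne_zero.2 n.factorial_ne_zero)

theorem hasSum_of_taylorAtZero {f : ℂ → ℂ} {R : ℝ} (hf : DifferentiableOn ℂ f (Metric.ball 0 R))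
    {z : ℂ} (hz : z ∈ Metric.ball 0 R) :
    HasSum (fun j => PowerSeries.coeff j (taylorAtZero f) * z ^ j) (f z) := by
  refine (hasSum_taylorSeries_on_ball hf hz).congr_fun fun j => ?_
  rw [taylorAtZero, PowerSeries.coeff_mk, sub_zero, smul_eq_mul, smul_eq_mul]
  ring

/-- The value of a real polynomial at a complex number. -/
noncomputable def cval (p : Polynomial ℝ) (z : ℂ) : ℂ := (p.map ofRealHom).eval z

theorem cval_mul (p q : Polynomial ℝ) (z : ℂ) : cval (p * q) z = cval p z * cval q z := by
  simp [cval]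

theorem cval_sub (p q : Polynomial ℝ) (z : ℂ) : cval (p - q) z = cval p z - cval q z := by
  simp [cval]

theorem cval_ofReal (p : Polynomial ℝ) (x : ℝ) : cval p x = (p.eval x : ℝ) := by
  rw [cval, Polynomial.eval_map]
  exact Polynomial.eval₂_at_apply ofRealHom x

theorem hasDerivAt_cval (p : Polynomial ℝ) (z : ℂ) :
    HasDerivAt (cval p) (cval (Polynomial.derivative p) z) z := by
  have := (p.map ofRealHom).hasDerivAt z
  rw [Polynomial.derivative_map] at this
  exact this

theorem differentiable_cval (p : Polynomial ℝ) : Differentiable ℂ (cval p) :=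
  fun z => (hasDerivAt_cval p z).differentiableAt

theorem taylorAtZero_cval (p : Polynomial ℝ) :
    taylorAtZero (cval p) = PowerSeries.map ofRealHom (p : PowerSeries ℝ) := by
  rw [← Polynomial.polynomial_map_coe]
  exact taylorAtZero_polynomial _

theorem map_derivative (f : PowerSeries ℝ) :
    PowerSeries.map ofRealHom (PowerSeries.derivative ℝ f) =
      PowerSeries.derivative ℂ (PowerSeries.map ofRealHom f) := by
  ext n
  simp [PowerSeries.coeff_derivative]

/-- `h` is the primitive of `N'/N - D'/D` with `h 0 = 0`, a branch of `log (N/D)`. The hypotheses on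
`c` say formally that `c k` is the `k`-th power of that logarithm over `k!`. -/
theorem exists_log {N D : Polynomial ℝ} {e : PowerSeries ℝ} {c : ℕ → PowerSeries ℝ} {R : ℝ}
    (hR : 0 < R) (hN0 : N.coeff 0 = 1) (hD0 : D.coeff 0 = 1)
    (hN : ∀ z ∈ Metric.ball (0 : ℂ) R, cval N z ≠ 0)
    (hD : ∀ z ∈ Metric.ball (0 : ℂ) R, cval D z ≠ 0)
    (he : e * ((N * D : Polynomial ℝ) : PowerSeries ℝ) =
      ((Polynomial.derivative N * D - N * Polynomial.derivative D : Polynomial ℝ) : PowerSeries ℝ))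
    (hc : ∀ k, PowerSeries.constantCoeff (c k) = if k = 0 then 1 else 0)
    (hc0 : PowerSeries.derivative ℝ (c 0) = 0)
    (hcs : ∀ k, PowerSeries.derivative ℝ (c (k + 1)) = e * c k) :
    ∃ h : ℂ → ℂ, (∀ z ∈ Metric.ball (0 : ℂ) R, exp (h z) * cval D z = cval N z) ∧
      ∀ z ∈ Metric.ball (0 : ℂ) R, ∀ k,
        HasSum (fun j => ((PowerSeries.coeff j (c k) : ℝ) : ℂ) * z ^ j)
          (h z ^ k / (k.factorial : ℂ)) := by
  set B := Metric.ball (0 : ℂ) R with hB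
  have hBo : IsOpen B := Metric.isOpen_ball
  have h0B : (0 : ℂ) ∈ B := Metric.mem_ball_self hR
  set G : Polynomial ℝ := Polynomial.derivative N * D - N * Polynomial.derivative D with hG
  set g : ℂ → ℂ := fun z => cval G z / cval (N * D) z with hg
  have hND : ∀ z ∈ B, cval (N * D) z ≠ 0 := fun z hz => by
    rw [cval_mul]; exact mul_ne_zero (hN z hz) (hD z hz)
  have hgd : DifferentiableOn ℂ g B :=
    (differentiable_cval G).differentiableOn.div (differentiable_cval (N * D)).differentiableOn hND
  obtain ⟨h, hh0, hh⟩ := hgd.isExactOn_ball.with_val_at 0 0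
  have hhd : DifferentiableOn ℂ h B := fun z hz => (hh z hz).differentiableAt.differentiableWithinAt
  have hval0 : ∀ p : Polynomial ℝ, p.coeff 0 = 1 → cval p 0 = 1 := fun p hp => by
    have := cval_ofReal p 0
    rw [← Polynomial.coeff_zero_eq_eval_zero, hp] at this
    simpa using this
  refine ⟨h, ?_, ?_⟩
  · have hder : ∀ z ∈ B, HasDerivAt (fun z => exp (h z) * cval D z / cval N z) 0 z := by
      intro z hz
      have h1 := (((hh z hz).cexp.mul (hasDerivAt_cval D z)).div (hasDerivAt_cval N z) (hN z hz))
      refine h1.congr_deriv ?_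
      have h2 := hN z hz
      have h3 := hD z hz
      rw [hg, hG]
      simp only [cval_sub, cval_mul]
      field_simp
      simp only [Pi.mul_apply]
      ring
    intro z hz
    have hconst := (convex_ball (0 : ℂ) R).is_const_of_fderivWithin_eq_zero (𝕜 := ℂ)
      (f := fun z => exp (h z) * cval D z / cval N z)
      (fun z hz => (hder z hz).differentiableAt.differentiableWithinAt)
      (fun z hz => by
        rw [fderivWithin_of_isOpen hBo hz]
        simpa using (hder z hz).hasFDerivAt.fderiv) hz h0B
    simp only [hh0, hval0 N hN0, hval0 D hD0, exp_zero] at hconst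
    field_simp [hN z hz] at hconst
    simpa using hconst
  · have han : ∀ f : ℂ → ℂ, DifferentiableOn ℂ f B → AnalyticAt ℂ f 0 := fun f hf =>
      hf.analyticAt (hBo.mem_nhds h0B)
    -- Both series have the same product with `N * D`, which is nonzero since its constant term is
    -- 1.
    have hgt : taylorAtZero g = PowerSeries.map ofRealHom e := by
      have h1 : taylorAtZero g * PowerSeries.map ofRealHom ((N * D : Polynomial ℝ) : PowerSeries ℝ) =
          PowerSeries.map ofRealHom e *
            PowerSeries.map ofRealHom ((N * D : Polynomial ℝ) : PowerSeries ℝ) := by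
        rw [← map_mul, he, ← taylorAtZero_cval, ← taylorAtZero_cval,
          ← taylorAtZero_mul (han g hgd) (han _ (differentiable_cval _).differentiableOn)]
        refine taylorAtZero_congr ?_
        filter_upwards [hBo.mem_nhds h0B] with z hz
        exact div_mul_cancel₀ _ (hND z hz)
      refine mul_right_cancel₀ ?_ h1
      intro h2
      have h3 := congrArg (PowerSeries.coeff 0) h2
      rw [PowerSeries.coeff_map, Polynomial.coeff_coe, Polynomial.mul_coeff_zero, hN0, hD0] at h3
      simp at h3
    have hfd : ∀ k : ℕ, DifferentiableOn ℂ (fun z => h z ^ k / (k.factorial : ℂ)) B :=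
      fun k => (hhd.pow k).div_const _
    have hcm : ∀ f : PowerSeries ℝ, PowerSeries.constantCoeff (PowerSeries.map ofRealHom f) =
        ofRealHom (PowerSeries.constantCoeff f) := fun f => by
      rw [← PowerSeries.coeff_zero_eq_constantCoeff_apply, PowerSeries.coeff_map,
        PowerSeries.coeff_zero_eq_constantCoeff_apply]
    -- Both sides satisfy the same differential recursion in `k` with the same constant terms.
    have hct : ∀ k, taylorAtZero (fun z => h z ^ k / (k.factorial : ℂ)) =
        PowerSeries.map ofRealHom (c k) := by
      intro k
      induction k with
      | zero =>
        refine PowerSeries.derivative.ext ?_ ?_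
        · rw [← map_derivative, hc0, derivative_taylorAtZero, map_zero]
          have : deriv (fun z => h z ^ 0 / ((Nat.factorial 0 : ℕ) : ℂ)) = cval 0 := by
            ext z; simp [cval]
          rw [this, taylorAtZero_cval]
          simp
        · rw [constantCoeff_taylorAtZero, hcm, hc]; simp
      | succ k ih =>
        refine PowerSeries.derivative.ext ?_ ?_
        · rw [← map_derivative, hcs, derivative_taylorAtZero, map_mul, ← ih, ← hgt,
            ← taylorAtZero_mul (han g hgd) (han _ (hfd k))]
          refine taylorAtZero_congr ?_
          filter_upwards [hBo.mem_nhds h0B] with z hz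
          rw [(((hh z hz).fun_pow (k + 1)).div_const _).deriv, Nat.factorial_succ]
          have h1 := Nat.cast_ne_zero (R := ℂ).2 k.factorial_ne_zero
          have h2 : (k : ℂ) + 1 ≠ 0 := Nat.cast_add_one_ne_zero k
          push_cast
          field_simp
        · rw [constantCoeff_taylorAtZero, hcm, hc]; simp [hh0]
    intro z hz k
    have := hasSum_of_taylorAtZero (hfd k) hz
    rw [hct k] at this
    simpa using this

end PascalRows

namespace PascalRows

open Finset Complex Filter Topology

/-! ### Bounds for the radius of convergence and evaluation at 1 -/

theorem le_radiusOfConvergence {c : ℕ → ℝ} {R : ℝ}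
    (h : ∀ z ∈ Metric.ball (0 : ℂ) R, Summable fun j => (c j : ℂ) * z ^ j) :
    ENNReal.ofReal R ≤ radiusOfConvergence c := by
  refine ENNReal.le_of_forall_nnreal_lt fun r hr => ?_
  refine FormalMultilinearSeries.le_radius_of_summable_norm _ ?_
  have hr' : (r : ℝ) < R := by
    by_contra hc
    have := ENNReal.ofReal_le_ofReal (not_lt.1 hc)
    rw [ENNReal.ofReal_coe_nnreal] at this
    exact absurd hr (not_lt.2 this)
  have := (h (r : ℝ) (by simpa using hr')).norm
  refine this.congr fun j => ?_
  rw [FormalMultilinearSeries.ofScalars_norm, norm_mul, norm_pow]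
  simp

section Log

variable {N D : Polynomial ℝ} {c : ℕ → PowerSeries ℝ} {R : ℝ} {h : ℂ → ℂ}

theorem one_lt_radius_and_hasSum (hR : 1 < R)
    (hD : ∀ z ∈ Metric.ball (0 : ℂ) R, cval D z ≠ 0)
    (hexp : ∀ z ∈ Metric.ball (0 : ℂ) R, exp (h z) * cval D z = cval N z)
    (hsum : ∀ z ∈ Metric.ball (0 : ℂ) R, ∀ k,
        HasSum (fun j => ((PowerSeries.coeff j (c k) : ℝ) : ℂ) * z ^ j)
          (h z ^ k / (k.factorial : ℂ)))
    (k : ℕ) :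
    1 < radiusOfConvergence (fun j => PowerSeries.coeff j (c k)) ∧
      HasSum (fun j => PowerSeries.coeff j (c k))
        (Real.log (N.eval 1 / D.eval 1) ^ k / (k.factorial : ℝ)) := by
  have h1 : (1 : ℂ) ∈ Metric.ball (0 : ℂ) R := by simpa using hR
  refine ⟨lt_of_lt_of_le ?_ (le_radiusOfConvergence fun z hz => (hsum z hz k).summable), ?_⟩
  · rw [← ENNReal.ofReal_one]
    exact (ENNReal.ofReal_lt_ofReal_iff (by linarith)).2 hR
  -- For `k = 1` the series of `h` at 1 has real terms, so `h 1` is the real logarithm, with no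
  -- multiple of `2πi`.
  have hre : ((h 1).re : ℂ) = h 1 := by
    have him := ((Complex.hasSum_iff _ _).1 (hsum 1 h1 1)).2
    simp only [one_pow, mul_one, ofReal_im, pow_one, Nat.factorial_one, Nat.cast_one,
      div_one] at him
    exact Complex.ext (by simp) (by simpa using (him.unique hasSum_zero).symm)
  have hlog : (h 1).re = Real.log (N.eval 1 / D.eval 1) := by
    have e := hexp 1 h1
    have hD1 := hD 1 h1
    rw [← ofReal_one, cval_ofReal] at hD1
    rw [← hre, ← ofReal_one, cval_ofReal, cval_ofReal, ← ofReal_exp, ← ofReal_mul,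
      ofReal_inj] at e
    rw [← e, mul_div_cancel_right₀ _ (by exact_mod_cast hD1), Real.log_exp]
    simp
  rw [← hlog, ← Complex.hasSum_ofReal]
  have := hsum 1 h1 k
  simp only [one_pow, mul_one] at this
  push_cast
  rwa [hre]

/-- A larger radius would keep `h ^ k`, hence `h`, bounded along the ray to `ζ`; then `exp h * D`
stays away from 0 there, although `N` tends to 0. -/
theorem radius_le_of_zero (hR : 0 < R)
    (hexp : ∀ z ∈ Metric.ball (0 : ℂ) R, exp (h z) * cval D z = cval N z)
    {k : ℕ} (hk : k ≠ 0) {a : ℕ → ℝ}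
    (hsum : ∀ z ∈ Metric.ball (0 : ℂ) R,
        HasSum (fun j => (a j : ℂ) * z ^ j) (h z ^ k / (k.factorial : ℂ)))
    {ζ : ℂ} (hζ : ‖ζ‖ = R) (hN : cval N ζ = 0) (hD : cval D ζ ≠ 0) :
    radiusOfConvergence a ≤ ENNReal.ofReal R := by
  by_contra hlt
  rw [not_le] at hlt
  set p := FormalMultilinearSeries.ofScalars ℂ (fun j => (a j : ℂ)) with hp
  have hpos : 0 < p.radius := lt_of_le_of_lt (zero_le) hlt
  have hmem : ζ ∈ Metric.eball (0 : ℂ) p.radius := by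
    rw [Metric.mem_eball, edist_zero_right, ← ofReal_norm, hζ]
    exact hlt
  have hcont : ContinuousAt p.sum ζ :=
    (p.hasFPowerSeriesOnBall hpos).continuousOn.continuousAt (Metric.isOpen_eball.mem_nhds hmem)
  have hpath : Tendsto (fun t : ℝ => (t : ℂ) * ζ) (𝓝[<] 1) (𝓝 ζ) := by
    have : ContinuousAt (fun t : ℝ => (t : ℂ) * ζ) 1 := by fun_prop
    have h2 := this.tendsto
    simp only [ofReal_one, one_mul] at h2
    exact h2.mono_left nhdsWithin_le_nhds
  have hball : ∀ᶠ t : ℝ in 𝓝[<] 1, (t : ℂ) * ζ ∈ Metric.ball (0 : ℂ) R := by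
    filter_upwards [Ioo_mem_nhdsLT (show (0 : ℝ) < 1 by norm_num)] with t ht
    rw [mem_ball_zero_iff, norm_mul, hζ, norm_real, Real.norm_of_nonneg ht.1.le]
    nlinarith [ht.1, ht.2]
  obtain ⟨K, hK⟩ : ∃ K : ℝ, ∀ᶠ t : ℝ in 𝓝[<] 1, ‖p.sum ((t : ℂ) * ζ)‖ ≤ K := by
    refine ⟨‖p.sum ζ‖ + 1, ?_⟩
    have := (hcont.tendsto.comp hpath).norm
    filter_upwards [this.eventually (gt_mem_nhds (lt_add_one ‖p.sum ζ‖))] with t ht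
    exact ht.le
  -- Either `‖h‖ ≤ 1`, or `‖h‖ ≤ ‖h‖ ^ k`, since `k ≠ 0`.
  set K' := max 1 (K * k.factorial) with hK'
  have hbd : ∀ᶠ t : ℝ in 𝓝[<] 1,
      Real.exp (-K') * ‖cval D ((t : ℂ) * ζ)‖ ≤ ‖cval N ((t : ℂ) * ζ)‖ := by
    filter_upwards [hball, hK] with t ht hKt
    have hs : p.sum ((t : ℂ) * ζ) = h (t * ζ) ^ k / (k.factorial : ℂ) := by
      rw [← (hsum _ ht).tsum_eq, hp]
      exact (FormalMultilinearSeries.ofScalars_sum_eq ..).trans (by simp)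
    have hpow : ‖h (t * ζ)‖ ^ k ≤ K * k.factorial := by
      rw [hs, norm_div, norm_pow, Complex.norm_natCast] at hKt
      rwa [div_le_iff₀ (by exact_mod_cast k.factorial_pos)] at hKt
    have hle : ‖h (t * ζ)‖ ≤ K' := by
      by_cases h1 : ‖h (t * ζ)‖ ≤ 1
      · exact h1.trans (le_max_left _ _)
      · exact ((le_self_pow₀ (not_le.1 h1).le hk).trans hpow).trans (le_max_right _ _)
    rw [← hexp _ ht, norm_mul, Complex.norm_exp]
    refine mul_le_mul_of_nonneg_right (Real.exp_le_exp.2 ?_) (norm_nonneg _)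
    have := (abs_le.1 (Complex.abs_re_le_norm (h (t * ζ)))).1
    linarith
  have hlim := le_of_tendsto_of_tendsto
    ((((differentiable_cval D).continuous.tendsto ζ).comp hpath).norm.const_mul (Real.exp (-K')))
    (((differentiable_cval N).continuous.tendsto ζ).comp hpath).norm hbd
  rw [hN, norm_zero] at hlim
  have : 0 < Real.exp (-K') * ‖cval D ζ‖ := mul_pos (Real.exp_pos _) (norm_pos_iff.2 hD)
  linarith

end Log

end PascalRows

namespace PascalRows

open Complex

/-! ### Zeros of the polynomials of the words `1^s 0` and `1^s 00` -/

theorem cval_one (z : ℂ) : cval 1 z = 1 := by simp [cval]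

theorem cval_add (p q : Polynomial ℝ) (z : ℂ) : cval (p + q) z = cval p z + cval q z := by
  simp [cval]

theorem two_pow_succ_sub_one (s : ℕ) : 2 ^ (s + 1) - 1 = 2 * (2 ^ s - 1) + 1 := by
  have := Nat.two_pow_pos s
  rw [pow_succ]; omega

theorem Tbar_ones (s : ℕ) : Tbar 2 (2 ^ s - 1) = 1 := by
  induction s with
  | zero => exact Tbar_zero
  | succ s ih => rw [two_pow_succ_sub_one, Tbar_odd, ih]

/-- The normalized polynomial of the word `1^s 0`. -/
noncomputable def onesZero (s : ℕ) : Polynomial ℝ := Tbar 2 (2 * (2 ^ s - 1))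

/-- The normalized polynomial of the word `1^s 00`. -/
noncomputable def onesZeroZero (s : ℕ) : Polynomial ℝ := Tbar 2 (2 * (2 * (2 ^ s - 1)))

theorem onesZero_zero : onesZero 0 = 1 := Tbar_zero

theorem onesZero_succ (s : ℕ) :
    onesZero (s + 1) = 1 + Polynomial.C (1 / 2) * Polynomial.X * onesZero s := by
  rw [onesZero, two_pow_succ_sub_one, Tbar_four_add_two, Tbar_ones, onesZero]

theorem onesZeroZero_eq (s : ℕ) :
    onesZeroZero s = onesZero s + 2 * Polynomial.X * (onesZero s - 1) := by
  rw [onesZeroZero, Tbar_four, Tbar_ones, onesZero]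

theorem cval_onesZero (s : ℕ) (z : ℂ) :
    cval (onesZero s) z * (1 - z / 2) = 1 - (z / 2) ^ (s + 1) := by
  induction s with
  | zero => rw [onesZero_zero, cval_one]; ring
  | succ s ih =>
    have h : cval (onesZero (s + 1)) z = 1 + z / 2 * cval (onesZero s) z := by
      have hX : cval (Polynomial.C (1 / 2) * Polynomial.X) z = z / 2 := by
        simp [cval]; ring
      rw [onesZero_succ, cval_add, cval_mul, cval_one, hX]
    rw [h]
    linear_combination (z / 2) * ih

theorem cval_onesZeroZero (s : ℕ) (z : ℂ) :
    cval (onesZeroZero s) z * (1 - z / 2) = 1 + z ^ 2 - (z / 2) ^ (s + 1) * (1 + 2 * z) := by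
  have h : cval (onesZeroZero s) z =
      cval (onesZero s) z + 2 * z * (cval (onesZero s) z - 1) := by
    rw [onesZeroZero_eq, cval_add, cval_mul, cval_sub, cval_one]
    simp [cval]
  rw [h]
  linear_combination (1 + 2 * z) * cval_onesZero s z

theorem cval_onesZero_ne_zero (s : ℕ) {z : ℂ} (hz : ‖z‖ < 2) : cval (onesZero s) z ≠ 0 := by
  intro h
  have h1 := cval_onesZero s z
  rw [h, zero_mul, eq_comm, sub_eq_zero] at h1
  have h2 : ‖z / 2‖ < 1 := by
    rw [norm_div, Complex.norm_two]; linarith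
  have h3 : ‖z / 2‖ ^ (s + 1) < 1 := pow_lt_one₀ (norm_nonneg _) h2 (Nat.succ_ne_zero s)
  rw [← norm_pow, ← h1, norm_one] at h3
  exact lt_irrefl _ h3

/-- Take `ζ = 2ω` with `ω` a primitive root of unity of order `s + 2`; a common zero would also give
`ω ^ (s + 1) = 1`, so `ω = 1`. -/
theorem exists_zero_onesZero (s : ℕ) :
    ∃ ζ : ℂ, ‖ζ‖ = 2 ∧ cval (onesZero (s + 1)) ζ = 0 ∧ cval (onesZero s) ζ ≠ 0 := by
  have hp := Complex.isPrimitiveRoot_exp (s + 2) (by omega)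
  set ω := exp (2 * Real.pi * I / ((s + 2 : ℕ) : ℂ)) with hω
  have h1 : ω ≠ 1 := hp.ne_one (by omega)
  have hpow : ω ^ (s + 2) = 1 := hp.pow_eq_one
  have h3 : (1 : ℂ) - 2 * ω / 2 ≠ 0 := by
    rw [mul_div_cancel_left₀ _ two_ne_zero]; exact sub_ne_zero.2 h1.symm
  refine ⟨2 * ω, ?_, ?_, ?_⟩
  · rw [norm_mul, Complex.norm_two, hp.norm'_eq_one (by omega), mul_one]
  · have h2 := cval_onesZero (s + 1) (2 * ω)
    rw [mul_div_cancel_left₀ _ (two_ne_zero' ℂ), hpow, sub_self] at h2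
    rw [mul_div_cancel_left₀ _ (two_ne_zero' ℂ)] at h3
    exact (mul_eq_zero.1 h2).resolve_right h3
  · intro h
    have h2 := cval_onesZero s (2 * ω)
    rw [h, zero_mul, mul_div_cancel_left₀ _ (two_ne_zero' ℂ), eq_comm, sub_eq_zero] at h2
    rw [pow_succ, ← h2, one_mul] at hpow
    exact h1 hpow

theorem norm_pow_sub_one_le {u : ℂ} (hu : ‖u‖ ≤ 1) (n : ℕ) : ‖u ^ n - 1‖ ≤ n * ‖u - 1‖ := by
  induction n with
  | zero => simp
  | succ n ih =>
    rw [show u ^ (n + 1) - 1 = (u ^ n - 1) * u + (u - 1) by ring]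
    refine (norm_add_le _ _).trans ?_
    rw [norm_mul]
    push_cast
    nlinarith [norm_nonneg (u ^ n - 1)]

/-- A point of the closed unit disc satisfying the equation is close to `1` after rotation. -/
theorem norm_sub_one_le {u σ : ℂ} {n : ℕ} (hu : ‖u‖ ≤ 1) (hre : 0 ≤ u.re) (hσ : ‖σ‖ = 1)
    (h : 2 ^ n * (1 - u ^ 2) = σ ^ n * u ^ n * (1 + 2 * σ * u)) : 2 ^ n * ‖u - 1‖ ≤ 3 := by
  have h1 : (1 : ℝ) ≤ ‖u + 1‖ := by
    have := Complex.re_le_norm (u + 1)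
    simp at this
    linarith
  have h2 : ‖1 + 2 * σ * u‖ ≤ 3 := by
    refine (norm_add_le _ _).trans ?_
    rw [norm_one, norm_mul, norm_mul, hσ, Complex.norm_two]
    linarith
  have h3 := congrArg norm h
  rw [norm_mul, norm_mul, norm_mul, norm_pow, norm_pow, norm_pow, hσ, Complex.norm_two, one_pow,
    one_mul, show (1 : ℂ) - u ^ 2 = -((u - 1) * (u + 1)) by ring, norm_neg, norm_mul] at h3
  have h4 : ‖u‖ ^ n * ‖1 + 2 * σ * u‖ ≤ 1 * 3 :=
    mul_le_mul (pow_le_one₀ (norm_nonneg _) hu) h2 (norm_nonneg _) zero_le_one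
  have h5 : (0 : ℝ) < 2 ^ n := by positivity
  have h6 : 2 ^ n * ‖u - 1‖ ≤ 2 ^ n * (‖u - 1‖ * ‖u + 1‖) :=
    mul_le_mul_of_nonneg_left (le_mul_of_one_le_right (norm_nonneg _) h1) h5.le
  linarith

theorem linear_lt_two_pow {n : ℕ} (hn : 6 ≤ n) : 6 + 9 * n < 2 ^ n := by
  induction n, hn using Nat.le_induction with
  | base => norm_num
  | succ n hn ih => rw [pow_succ]; omega

/-- The left side has nonnegative real part. As `u` is within `3 / 2 ^ n` of 1, the right side is
close to `σ ^ n * (1 + 2 * σ)`, which is `σ - 2` or `-1 - 2σ` for the two residues of `n` modulo 4,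
with real part -2 or -1. The error is at most `(2 + 3n) * ‖u - 1‖`, hence at most `(6 + 9n) / 2 ^
n`. -/
theorem rotated_equation_ne {u σ : ℂ} {s n : ℕ} (hs : 1 ≤ s) (hn : n = 4 * s + 1 ∨ n = 4 * s + 2)
    (hu : ‖u‖ ≤ 1) (hre : 0 ≤ u.re) (hσ2 : σ ^ 2 = -1) (hσre : σ.re = 0) (hσ : ‖σ‖ = 1) :
    2 ^ n * (1 - u ^ 2) ≠ σ ^ n * u ^ n * (1 + 2 * σ * u) := by
  intro h
  have hd := norm_sub_one_le hu hre hσ h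
  have hδ := norm_pow_sub_one_le hu n
  have hleft : 0 ≤ (2 ^ n * (1 - u ^ 2)).re := by
    have h1 : (u ^ 2).re ≤ 1 := by
      refine (Complex.re_le_norm _).trans ?_
      rw [norm_pow]
      exact pow_le_one₀ (norm_nonneg _) hu
    have e : (2 : ℂ) ^ n = ((2 ^ n : ℝ) : ℂ) := by push_cast; rfl
    rw [e, Complex.re_ofReal_mul, Complex.sub_re, Complex.one_re]
    exact mul_nonneg (by positivity) (by linarith)
  have h4 : σ ^ 4 = 1 := by rw [show 4 = 2 * 2 by rfl, pow_mul, hσ2]; norm_num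
  have hsmall : (6 + 9 * n : ℝ) * ‖u - 1‖ * 2 ^ n ≤ 3 * (6 + 9 * n) := by
    have : (0 : ℝ) ≤ 6 + 9 * n := by positivity
    nlinarith
  have hpos : (0 : ℝ) < 2 ^ n := by positivity
  rw [h] at hleft
  have hδ' : ∀ v : ℂ, ‖v‖ ≤ 3 → ((u ^ n - 1) * v).re ≤ 3 * (n * ‖u - 1‖) := fun v hv => by
    refine (Complex.re_le_norm _).trans ?_
    rw [norm_mul]
    nlinarith [norm_nonneg (u ^ n - 1), norm_nonneg v]
  have hv1 : ‖σ - 2 * u‖ ≤ 3 := by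
    refine (norm_sub_le _ _).trans ?_
    rw [norm_mul, hσ, Complex.norm_two]; linarith
  have hv2 : ‖-(1 + 2 * σ * u)‖ ≤ 3 := by
    rw [norm_neg]
    refine (norm_add_le _ _).trans ?_
    rw [norm_one, norm_mul, norm_mul, hσ, Complex.norm_two]; linarith
  rcases hn with hn | hn
  · have hσn : σ ^ n = σ := by rw [hn, pow_succ, pow_mul, h4]; simp
    rw [hσn, show σ * u ^ n * (1 + 2 * σ * u) =
      (u ^ n - 1) * (σ - 2 * u) + (σ + ((-2 : ℝ) : ℂ) * 1 + ((-2 : ℝ) : ℂ) * (u - 1)) by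
        push_cast; linear_combination (2 * u * u ^ n) * hσ2] at hleft
    rw [Complex.add_re, Complex.add_re, Complex.add_re, Complex.re_ofReal_mul,
      Complex.re_ofReal_mul, hσre, Complex.one_re] at hleft
    have h5 := hδ' _ hv1
    have h6 := (abs_le.1 (Complex.abs_re_le_norm (u - 1))).1
    have h7 : (6 + 9 * n : ℝ) < 2 * 2 ^ n := by
      have : 6 + 9 * n < 2 * 2 ^ n := by
        -- For `n = 5` the weaker bound `51 < 64` suffices, because the real part to beat is -2.
        rcases Nat.lt_or_ge n 6 with h | h
        · have : n = 5 := by omega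
          subst this; norm_num
        · have := linear_lt_two_pow h; omega
      exact_mod_cast this
    have h8 : 2 ≤ 2 * ‖u - 1‖ + 3 * (n * ‖u - 1‖) := by linarith
    have h9 : (0:ℝ) ≤ n := Nat.cast_nonneg n
    nlinarith
  · have hσn : σ ^ n = -1 := by rw [hn, pow_add, pow_mul, h4, hσ2]; simp
    rw [hσn, show -1 * u ^ n * (1 + 2 * σ * u) =
      (u ^ n - 1) * (-(1 + 2 * σ * u)) + (((-1 : ℝ) : ℂ) * 1 + ((-2 : ℝ) : ℂ) * σ
        + ((-2 : ℝ) : ℂ) * (σ * (u - 1))) by push_cast; ring] at hleft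
    rw [Complex.add_re, Complex.add_re, Complex.add_re, Complex.re_ofReal_mul,
      Complex.re_ofReal_mul, Complex.re_ofReal_mul, hσre, Complex.one_re] at hleft
    have h5 := hδ' _ hv2
    have h6 := (abs_le.1 (Complex.abs_re_le_norm (σ * (u - 1)))).1
    rw [norm_mul, hσ, one_mul] at h6
    have h7 : (6 + 9 * n : ℝ) < 2 ^ n := by exact_mod_cast linear_lt_two_pow (by omega)
    have h8 : 1 ≤ 2 * ‖u - 1‖ + 3 * (n * ‖u - 1‖) := by linarith
    have h9 : (0:ℝ) ≤ n := Nat.cast_nonneg n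
    nlinarith

theorem cval_onesZeroZero_ne_zero {s m : ℕ} (hs : 1 ≤ s) (hm : m = 4 * s ∨ m = 4 * s + 1) {z : ℂ}
    (hz : ‖z‖ ≤ 1) : cval (onesZeroZero m) z ≠ 0 := by
  intro h
  have h1 := cval_onesZeroZero m z
  rw [h, zero_mul] at h1
  -- Substitute `z = σu`. For `σ = I` and `σ = -I` the real part of `u` is `z.im` and `-z.im`, so
  -- one choice meets the half-plane condition.
  have key : ∀ σ : ℂ, σ ^ 2 = -1 → σ.re = 0 → ‖σ‖ = 1 → ¬ 0 ≤ (-σ * z).re := by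
    intro σ h2 h3 h4 h5
    have hu : ‖-σ * z‖ ≤ 1 := by rw [norm_mul, norm_neg, h4, one_mul]; exact hz
    refine rotated_equation_ne (n := m + 1) hs (by omega) hu h5 h2 h3 h4 ?_
    have e : (σ * (-σ * z)) = z := by linear_combination (-z) * h2
    rw [← mul_pow, mul_assoc 2, e, mul_pow, neg_sq, h2]
    have e2 : (2 : ℂ) ^ (m + 1) * (z / 2) ^ (m + 1) = z ^ (m + 1) := by
      rw [← mul_pow, mul_div_cancel₀ _ (two_ne_zero' ℂ)]
    linear_combination (- 2 ^ (m + 1)) * h1 + (1 + 2 * z) * e2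
  have k1 := key I I_sq I_re norm_I
  have k2 := key (-I) (by rw [neg_sq, I_sq]) (by simp) (by simp)
  simp at k1 k2
  linarith

theorem exists_ball_cval_ne_zero (p : Polynomial ℝ) (hp : ∀ z : ℂ, ‖z‖ ≤ 1 → cval p z ≠ 0) :
    ∃ R : ℝ, 1 < R ∧ ∀ z ∈ Metric.ball (0 : ℂ) R, cval p z ≠ 0 := by
  have hopen : IsOpen {z : ℂ | cval p z ≠ 0} :=
    isOpen_ne.preimage (differentiable_cval p).continuous
  obtain ⟨δ, hδ, hsub⟩ := (isCompact_closedBall (0 : ℂ) 1).exists_thickening_subset_open hopen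
    (fun z hz => hp z (by simpa using hz))
  rw [thickening_closedBall hδ zero_le_one] at hsub
  exact ⟨δ + 1, by linarith, fun z hz => hsub hz⟩

end PascalRows

namespace PascalRows

/-! ### The words `1^s 0` and `1^{4s+1} 00` -/

theorem wordValue_append_zero (w : List ℕ) : wordValue 2 (w ++ [0]) = 2 * wordValue 2 w := by
  simp [wordValue, Nat.ofDigits_cons]

theorem wordValue_ones (s : ℕ) : wordValue 2 (List.replicate s 1) = 2 ^ s - 1 := by
  induction s with
  | zero => simp [wordValue]
  | succ s ih =>
    rw [wordValue, List.reverse_replicate] at ih ⊢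
    rw [List.replicate_succ, Nat.ofDigits_cons, ih, two_pow_succ_sub_one]
    simp [add_comm]

theorem dropTop_two_pow_add {M a m : ℕ} (h : M = 2 ^ a + m) (hm : m < 2 ^ a) :
    dropTop M = m := by
  have hlog : Nat.log 2 M = a := Nat.log_eq_of_pow_le_of_lt_pow (by omega) (by rw [pow_succ]; omega)
  rw [dropTop, hlog, h, Nat.add_mod_left, Nat.mod_eq_of_lt hm]

theorem dropTop_ones (s : ℕ) : dropTop (2 ^ (s + 1) - 1) = 2 ^ s - 1 := by
  have := Nat.two_pow_pos s
  exact dropTop_two_pow_add (a := s) (by rw [pow_succ]; omega) (by omega)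

theorem dropTop_ones_zero (s : ℕ) : dropTop (2 * (2 ^ (s + 1) - 1)) = 2 * (2 ^ s - 1) := by
  have := Nat.two_pow_pos s
  exact dropTop_two_pow_add (a := s + 1) (by rw [pow_succ]; omega) (by rw [pow_succ]; omega)

theorem wordNum_ones (s : ℕ) : wordNum (2 ^ (s + 1) - 1) = onesZero (s + 1) := by
  rw [wordNum, dropTop_ones, Tbar_ones, mul_one, onesZero]

theorem wordDen_ones (s : ℕ) : wordDen (2 ^ (s + 1) - 1) = onesZero s := by
  rw [wordDen, dropTop_ones, Tbar_ones, one_mul, onesZero]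

theorem wordNum_ones_zero (s : ℕ) :
    wordNum (2 * (2 ^ (s + 1) - 1)) = onesZeroZero (s + 1) * onesZero s := by
  rw [wordNum, dropTop_ones_zero, onesZeroZero, onesZero]

theorem wordDen_ones_zero (s : ℕ) :
    wordDen (2 * (2 ^ (s + 1) - 1)) = onesZero (s + 1) * onesZeroZero s := by
  rw [wordDen, dropTop_ones_zero, onesZeroZero, onesZero]

theorem wordOf_eq_wordOne {s : ℕ} (hs : 1 ≤ s) :
    wordOf (2 ^ s - 1) = ⟨wordOne s, admissible_wordOne hs⟩ := by
  rw [← wordOf_wordValue ⟨wordOne s, admissible_wordOne hs⟩]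
  congr 1
  change 2 ^ s - 1 = wordValue 2 (wordOne s) / 2
  rw [wordOne, wordValue_append_zero, wordValue_ones]
  omega

theorem wordOf_eq_wordTwo (s : ℕ) :
    wordOf (2 * (2 ^ (4 * s + 1) - 1)) = ⟨wordTwo s, admissible_wordTwo s⟩ := by
  rw [← wordOf_wordValue ⟨wordTwo s, admissible_wordTwo s⟩]
  congr 1
  change 2 * (2 ^ (4 * s + 1) - 1) = wordValue 2 (wordTwo s) / 2
  rw [wordTwo, show [0, 0] = [0] ++ [0] by rfl, ← List.append_assoc, wordValue_append_zero,
    wordValue_append_zero, wordValue_ones]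
  omega

/-- `RatFunc.eval` uses the reduced fraction; its denominator divides `q`, so it does not vanish at
`x` either. -/
theorem eval_div_algebraMap {p q : Polynomial ℝ} {x : ℝ} (hq : q.eval x ≠ 0) :
    RatFunc.eval (RingHom.id ℝ) x
      (algebraMap (Polynomial ℝ) (RatFunc ℝ) p / algebraMap (Polynomial ℝ) (RatFunc ℝ) q) =
      p.eval x / q.eval x := by
  have hq0 : q ≠ 0 := by rintro rfl; simp at hq
  have hq' : algebraMap (Polynomial ℝ) (RatFunc ℝ) q ≠ 0 := by
    simpa using hq0
  set f := algebraMap (Polynomial ℝ) (RatFunc ℝ) p / algebraMap (Polynomial ℝ) (RatFunc ℝ) q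
    with hf
  have h1 : f * algebraMap (Polynomial ℝ) (RatFunc ℝ) q = algebraMap _ _ p :=
    div_mul_cancel₀ _ hq'
  have hden : Polynomial.eval₂ (RingHom.id ℝ) x (RatFunc.denom f) ≠ 0 := by
    obtain ⟨g, hg⟩ := RatFunc.denom_div_dvd p q
    intro h
    apply hq
    rw [hg, Polynomial.eval_mul, ← hf]
    rw [Polynomial.eval₂_id] at h
    rw [h, zero_mul]
  have h2 := RatFunc.eval_mul (f := RingHom.id ℝ) (a := x) hden
    (y := algebraMap (Polynomial ℝ) (RatFunc ℝ) q) (by simp)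
  rw [h1, RatFunc.eval_algebraMap, RatFunc.eval_algebraMap] at h2
  rw [eq_div_iff hq]
  simpa using h2.symm

theorem r_eq {w : List ℕ} {M : ℕ} (h1 : wordValue 2 w = 2 * M) (h2 : wordValue 2 (truncR w) = M)
    (h3 : wordValue 2 (truncL w) = 2 * dropTop M)
    (h4 : wordValue 2 (truncR (truncL w)) = dropTop M) :
    r 2 w = algebraMap (Polynomial ℝ) (RatFunc ℝ) (wordNum M) /
      algebraMap (Polynomial ℝ) (RatFunc ℝ) (wordDen M) := by
  simp only [r, TbarWord, h1, h2, h3, h4, wordNum, wordDen, map_mul]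

theorem r_wordOne (s : ℕ) : r 2 (wordOne (s + 1)) =
    algebraMap (Polynomial ℝ) (RatFunc ℝ) (onesZero (s + 1)) /
      algebraMap (Polynomial ℝ) (RatFunc ℝ) (onesZero s) := by
  rw [← wordNum_ones, ← wordDen_ones]
  refine r_eq ?_ ?_ ?_ ?_
  · rw [wordOne, wordValue_append_zero, wordValue_ones]
  · rw [truncR, wordOne, List.dropLast_concat, wordValue_ones]
  all_goals
    rw [dropTop_ones]
    -- For the word `10` the left truncation also strips the remaining 0 and leaves the empty word.
    rcases s with _ | s
    · simp [truncL, truncR, wordOne, wordValue]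
    · have : truncL (wordOne (s + 1 + 1)) = List.replicate (s + 1) 1 ++ [0] := by
        simp [truncL, wordOne, List.replicate_succ]
      rw [this]
      first
        | rw [wordValue_append_zero, wordValue_ones]
        | rw [truncR, List.dropLast_concat, wordValue_ones]

theorem r_wordTwo {s : ℕ} (hs : 1 ≤ s) : r 2 (wordTwo s) =
    algebraMap (Polynomial ℝ) (RatFunc ℝ) (onesZeroZero (4 * s + 1) * onesZero (4 * s)) /
      algebraMap (Polynomial ℝ) (RatFunc ℝ) (onesZero (4 * s + 1) * onesZeroZero (4 * s)) := by
  have e : ∀ m, List.replicate m 1 ++ [0, 0] = (List.replicate m 1 ++ [0]) ++ [0] := by simp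
  have hL : truncL (wordTwo s) = (List.replicate (4 * s) 1 ++ [0]) ++ [0] := by
    obtain ⟨t, ht⟩ := Nat.exists_eq_add_of_le' (show 1 ≤ 4 * s by omega)
    rw [truncL, wordTwo, ht]
    simp [List.replicate_succ]
  rw [← wordNum_ones_zero, ← wordDen_ones_zero]
  refine r_eq ?_ ?_ ?_ ?_
  · rw [wordTwo, e, wordValue_append_zero, wordValue_append_zero, wordValue_ones]
  · rw [truncR, wordTwo, e, List.dropLast_concat, wordValue_append_zero, wordValue_ones]
  · rw [hL, dropTop_ones_zero, wordValue_append_zero, wordValue_append_zero, wordValue_ones]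
  · rw [hL, dropTop_ones_zero, truncR, List.dropLast_concat, wordValue_append_zero, wordValue_ones]

theorem coeff_zero_wordNum (M : ℕ) : (wordNum M).coeff 0 = 1 := by
  rw [wordNum, Polynomial.mul_coeff_zero, coeff_zero_Tbar, coeff_zero_Tbar, one_mul]

theorem coeff_zero_wordDen (M : ℕ) : (wordDen M).coeff 0 = 1 := by
  rw [wordDen, Polynomial.mul_coeff_zero, coeff_zero_Tbar, coeff_zero_Tbar, one_mul]

theorem exists_log_word {M : ℕ} (hM : 1 ≤ M) {R : ℝ} (hR : 0 < R)
    (hN : ∀ z ∈ Metric.ball (0 : ℂ) R, cval (wordNum M) z ≠ 0)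
    (hD : ∀ z ∈ Metric.ball (0 : ℂ) R, cval (wordDen M) z ≠ 0) :
    ∃ h : ℂ → ℂ, (∀ z ∈ Metric.ball (0 : ℂ) R,
        Complex.exp (h z) * cval (wordDen M) z = cval (wordNum M) z) ∧
      ∀ z ∈ Metric.ball (0 : ℂ) R, ∀ k,
        HasSum (fun j => ((PowerSeries.coeff j (powSeries M k) : ℝ) : ℂ) * z ^ j)
          (h z ^ k / (k.factorial : ℂ)) :=
  exists_log hR (coeff_zero_wordNum M) (coeff_zero_wordDen M) hN hD (wordDlog_mul M)
    (constantCoeff_powSeries M) (derivative_powSeries_zero M) (derivative_powSeries_succ hM)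

theorem coeff_powSeries (M k : ℕ) :
    (fun j => PowerSeries.coeff j (powSeries M k)) =
      fun j => coeffPow (wordOf M) k (repPoly j) := by
  ext j; rw [powSeries, PowerSeries.coeff_mk]

theorem one_lt_radius_and_hasSum_word {M : ℕ} (hM : 1 ≤ M) {R : ℝ} (hR : 1 < R)
    (hN : ∀ z ∈ Metric.ball (0 : ℂ) R, cval (wordNum M) z ≠ 0)
    (hD : ∀ z ∈ Metric.ball (0 : ℂ) R, cval (wordDen M) z ≠ 0) {w : List ℕ}
    (hr : r 2 w = algebraMap (Polynomial ℝ) (RatFunc ℝ) (wordNum M) /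
      algebraMap (Polynomial ℝ) (RatFunc ℝ) (wordDen M)) (k : ℕ) :
    1 < radiusOfConvergence (fun j => coeffPow (wordOf M) k (repPoly j)) ∧
      HasSum (fun j => coeffPow (wordOf M) k (repPoly j))
        (Real.log (RatFunc.eval (RingHom.id ℝ) 1 (r 2 w)) ^ k / (k.factorial : ℝ)) := by
  obtain ⟨h, hexp, hsum⟩ := exists_log_word hM (by linarith) hN hD
  have hD1 : (wordDen M).eval 1 ≠ 0 := by
    have := hD 1 (by simpa using hR)
    rw [← Complex.ofReal_one, cval_ofReal] at this
    exact_mod_cast this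
  rw [hr, eval_div_algebraMap hD1, ← coeff_powSeries]
  exact one_lt_radius_and_hasSum hR hD hexp hsum k

theorem radius_wordOne {s : ℕ} (hs : 1 ≤ s) {k : ℕ} (hk : 1 ≤ k) :
    radiusOfConvergence (fun j => coeffPow ⟨wordOne s, admissible_wordOne hs⟩ k (repPoly j)) = 2 := by
  obtain ⟨t, rfl⟩ := Nat.exists_eq_add_of_le' hs
  have hM : 1 ≤ 2 ^ (t + 1) - 1 := by
    have := Nat.two_pow_pos t
    rw [pow_succ]; omega
  obtain ⟨h, hexp, hsum⟩ := exists_log_word hM (R := 2) two_pos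
    (fun z hz => by rw [wordNum_ones]; exact cval_onesZero_ne_zero _ (by simpa using hz))
    (fun z hz => by rw [wordDen_ones]; exact cval_onesZero_ne_zero _ (by simpa using hz))
  obtain ⟨ζ, hζ, hN, hD⟩ := exists_zero_onesZero t
  rw [← wordOf_eq_wordOne hs, ← coeff_powSeries, ← ENNReal.ofReal_ofNat]
  refine le_antisymm ?_ (le_radiusOfConvergence fun z hz => (hsum z hz k).summable)
  exact radius_le_of_zero two_pos hexp (by omega) (fun z hz => hsum z hz k) hζ
    (by rwa [wordNum_ones]) (by rwa [wordDen_ones])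

theorem one_lt_radius_and_hasSum_wordOne {s : ℕ} (hs : 1 ≤ s) (k : ℕ) :
    1 < radiusOfConvergence
        (fun j => coeffPow ⟨wordOne s, admissible_wordOne hs⟩ k (repPoly j)) ∧
      HasSum (fun j => coeffPow ⟨wordOne s, admissible_wordOne hs⟩ k (repPoly j))
        (Real.log (RatFunc.eval (RingHom.id ℝ) 1 (r 2 (wordOne s))) ^ k / (k.factorial : ℝ)) := by
  obtain ⟨t, rfl⟩ := Nat.exists_eq_add_of_le' hs
  have hM : 1 ≤ 2 ^ (t + 1) - 1 := by
    have := Nat.two_pow_pos t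
    rw [pow_succ]; omega
  rw [← wordOf_eq_wordOne hs]
  refine one_lt_radius_and_hasSum_word hM (R := 2) one_lt_two
    (fun z hz => by rw [wordNum_ones]; exact cval_onesZero_ne_zero _ (by simpa using hz))
    (fun z hz => by rw [wordDen_ones]; exact cval_onesZero_ne_zero _ (by simpa using hz)) ?_ k
  rw [wordNum_ones, wordDen_ones, r_wordOne]

theorem one_lt_radius_and_hasSum_wordTwo {s : ℕ} (hs : 1 ≤ s) (k : ℕ) :
    1 < radiusOfConvergence
        (fun j => coeffPow ⟨wordTwo s, admissible_wordTwo s⟩ k (repPoly j)) ∧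
      HasSum (fun j => coeffPow ⟨wordTwo s, admissible_wordTwo s⟩ k (repPoly j))
        (Real.log (RatFunc.eval (RingHom.id ℝ) 1 (r 2 (wordTwo s))) ^ k / (k.factorial : ℝ)) := by
  have hM : 1 ≤ 2 * (2 ^ (4 * s + 1) - 1) := by
    have := Nat.two_pow_pos (4 * s)
    rw [pow_succ]; omega
  have hlt : ∀ z : ℂ, ‖z‖ ≤ 1 → ‖z‖ < 2 := fun z hz => by linarith
  obtain ⟨R, hR, hne⟩ := exists_ball_cval_ne_zero
    (wordNum (2 * (2 ^ (4 * s + 1) - 1)) * wordDen (2 * (2 ^ (4 * s + 1) - 1))) fun z hz => by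
      rw [wordNum_ones_zero, wordDen_ones_zero, cval_mul, cval_mul, cval_mul]
      exact mul_ne_zero
        (mul_ne_zero (cval_onesZeroZero_ne_zero hs (Or.inr rfl) hz)
          (cval_onesZero_ne_zero _ (hlt z hz)))
        (mul_ne_zero (cval_onesZero_ne_zero _ (hlt z hz))
          (cval_onesZeroZero_ne_zero hs (Or.inl rfl) hz))
  simp only [cval_mul] at hne
  rw [← wordOf_eq_wordTwo]
  refine one_lt_radius_and_hasSum_word hM hR (fun z hz => left_ne_zero_of_mul (hne z hz))
    (fun z hz => right_ne_zero_of_mul (hne z hz)) ?_ k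
  rw [wordNum_ones_zero, wordDen_ones_zero, r_wordTwo hs]

end PascalRows

theorem mainTheorem9 :
    ∃ P : ℕ → MvPolynomial (PascalRows.AdmissibleWord 2) ℝ,
      (∀ (j : ℕ) (Q : MvPolynomial (PascalRows.AdmissibleWord 2) ℝ),
        PascalRows.Represents 2 j Q ↔ Q = P j) ∧
      (∀ (s : ℕ) (hs : 1 ≤ s) (k : ℕ) (w : PascalRows.AdmissibleWord 2),
        (w = ⟨PascalRows.wordOne s, PascalRows.admissible_wordOne hs⟩ ∨
          w = ⟨PascalRows.wordTwo s, PascalRows.admissible_wordTwo s⟩) →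
        1 < PascalRows.radiusOfConvergence (fun j => PascalRows.coeffPow w k (P j)) ∧
        HasSum (fun j => PascalRows.coeffPow w k (P j))
          (Real.log (RatFunc.eval (RingHom.id ℝ) 1 (PascalRows.r 2 w.1)) ^ k /
            (k.factorial : ℝ))) ∧
      (∀ (s : ℕ) (hs : 1 ≤ s) (k : ℕ), 1 ≤ k →
        PascalRows.radiusOfConvergence (fun j =>
          PascalRows.coeffPow ⟨PascalRows.wordOne s, PascalRows.admissible_wordOne hs⟩ k (P j)) =
            2) := by
  refine ⟨PascalRows.repPoly, PascalRows.represents_iff, ?_, fun s hs k hk =>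
    PascalRows.radius_wordOne hs hk⟩
  rintro s hs k w (rfl | rfl)
  · exact PascalRows.one_lt_radius_and_hasSum_wordOne hs k
  · exact PascalRows.one_lt_radius_and_hasSum_wordTwo hs k
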